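/- Let $k \ge 1$ be a fixed integer. An instance of $k$-MHE (Maximum Happy Edges) consists of a finite simple undirected graph $G=(V,E)$, a partial vertex-coloring $c : S \to [k]$ with $S \subseteq V$, and an integer $\ell$; the question is whether there is a full coloring $c' : V \to [k]$ with $c'(v)=c(v)$ for all $v\in S$ such that at least $\ell$ edges of $G$ are happy, i.e. have both endpoints of the same color under $c'$. Two vertices $u,v$ of $G$ have the same type if $N(u)\setminus\{v\}=N(v)\setminus\{u\}$, and the neighborhood diversity of $G$ is the least number $t$ such that $V$ can be partitioned into $t$ sets, each consisting of vertices of the same type. Theorem. For every $k \ge 1$, $k$-MHE can be solved in time $O^*(2^t)$, where $t$ is the neighborhood diversity of the input graph. That is, for every $k\ge 1$ there are an algorithm (a program for a random access machine with logarithmic cost, given $G$ by its adjacency matrix and $\ell$ in binary) and a polynomial $p$ such that on every instance $(G,c,\ell)$ of $k$-MHE with $n$ vertices and neighborhood diversity $t$ the algorithm halts with the correct answer after time at most $2^t\cdot p(n+b)$, where $b$ is the number of binary digits of $|\ell|$. -/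

import Mathlib

/-! ### Random access machines with logarithmic cost

Programs are structured (sequencing, branching, loops) over the usual instruction set of a
random access machine. Every instruction is charged the total bit length of the numbers and
memory addresses it handles, plus one. -/

namespace RAM

/-- `reg` are the registers named in the program text (a program uses finitely many of them),
`mem` is the memory, which is accessed indirectly, through addresses held in registers. -/
structure State where
  reg : ℕ → ℕ
  mem : ℕ → ℕ

def State.setReg (s : State) (d x : ℕ) : State :=
  { s with reg := Function.update s.reg d x }

def State.setMem (s : State) (a x : ℕ) : State :=
  { s with mem := Function.update s.mem a x }

/-- Arithmetic instructions: addition, truncated subtraction, multiplication, integer division. -/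
inductive Op where
  | add
  | sub
  | mul
  | div

def Op.eval : Op → ℕ → ℕ → ℕ
  | .add, x, y => x + y
  | .sub, x, y => x - y
  | .mul, x, y => x * y
  | .div, x, y => x / y

/-- Programs. Informally:
* `const d c` is `reg[d] := c`;
* `arith o d a b` is `reg[d] := reg[a] o reg[b]`;
* `load d a` is `reg[d] := mem[reg[a]]`;
* `store a b` is `mem[reg[a]] := reg[b]`;
* `ite a p q` is `if reg[a] ≠ 0 then p else q`;
* `loop a p` is `while reg[a] ≠ 0 do p`. -/
inductive Prog where
  | skip
  | const (d c : ℕ)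
  | arith (o : Op) (d a b : ℕ)
  | load (d a : ℕ)
  | store (a b : ℕ)
  | seq (p q : Prog)
  | ite (a : ℕ) (p q : Prog)
  | loop (a : ℕ) (p : Prog)

/-- `Exec p s T s'`: started in state `s`, the program `p` halts in state `s'`, and the
logarithmic cost of the run is `T`. (`Nat.size x` is the number of binary digits of `x`.) -/
inductive Exec : Prog → State → ℕ → State → Prop where
  | skip (s : State) : Exec .skip s 1 s
  | const (s : State) (d c : ℕ) :
      Exec (.const d c) s (1 + Nat.size c) (s.setReg d c)
  | arith (s : State) (o : Op) (d a b : ℕ) :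
      Exec (.arith o d a b) s (1 + Nat.size (s.reg a) + Nat.size (s.reg b))
        (s.setReg d (o.eval (s.reg a) (s.reg b)))
  | load (s : State) (d a : ℕ) :
      Exec (.load d a) s (1 + Nat.size (s.reg a) + Nat.size (s.mem (s.reg a)))
        (s.setReg d (s.mem (s.reg a)))
  | store (s : State) (a b : ℕ) :
      Exec (.store a b) s (1 + Nat.size (s.reg a) + Nat.size (s.reg b))
        (s.setMem (s.reg a) (s.reg b))
  | seq {p q : Prog} {s s' s'' : State} {T T' : ℕ} :
      Exec p s T s' → Exec q s' T' s'' → Exec (.seq p q) s (T + T') s''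
  | ite_true {a : ℕ} {p q : Prog} {s s' : State} {T : ℕ} :
      s.reg a ≠ 0 → Exec p s T s' → Exec (.ite a p q) s (1 + Nat.size (s.reg a) + T) s'
  | ite_false {a : ℕ} {p q : Prog} {s s' : State} {T : ℕ} :
      s.reg a = 0 → Exec q s T s' → Exec (.ite a p q) s (1 + Nat.size (s.reg a) + T) s'
  | loop_done {a : ℕ} {p : Prog} {s : State} :
      s.reg a = 0 → Exec (.loop a p) s (1 + Nat.size (s.reg a)) s
  | loop_step {a : ℕ} {p : Prog} {s s' s'' : State} {T T' : ℕ} :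
      s.reg a ≠ 0 → Exec p s T s' → Exec (.loop a p) s' T' s'' →
        Exec (.loop a p) s (1 + Nat.size (s.reg a) + T + T') s''

/-- The machine is deterministic: final state and cost are functions of the start. -/
theorem Exec.deterministic {p : Prog} {s s₁ s₂ : State} {T₁ T₂ : ℕ}
    (h₁ : Exec p s T₁ s₁) (h₂ : Exec p s T₂ s₂) : T₁ = T₂ ∧ s₁ = s₂ := by
  induction h₁ generalizing T₂ s₂ with
  | skip | const | arith | load | store => cases h₂; exact ⟨rfl, rfl⟩
  | seq _ _ ih ih' =>
    cases h₂ with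
    | seq g g' =>
      obtain ⟨rfl, rfl⟩ := ih g
      obtain ⟨rfl, rfl⟩ := ih' g'
      exact ⟨rfl, rfl⟩
  | ite_true h _ ih =>
    cases h₂ with
    | ite_true _ g => obtain ⟨rfl, rfl⟩ := ih g; exact ⟨rfl, rfl⟩
    | ite_false g _ => exact absurd g h
  | ite_false h _ ih =>
    cases h₂ with
    | ite_true g _ => exact absurd h g
    | ite_false _ g => obtain ⟨rfl, rfl⟩ := ih g; exact ⟨rfl, rfl⟩
  | loop_done h =>
    cases h₂ with
    | loop_done _ => exact ⟨rfl, rfl⟩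
    | loop_step g _ _ => exact absurd h g
  | loop_step h _ _ ih ih' =>
    cases h₂ with
    | loop_done g => exact absurd g h
    | loop_step _ g g' =>
      obtain ⟨rfl, rfl⟩ := ih g
      obtain ⟨rfl, rfl⟩ := ih' g'
      exact ⟨rfl, rfl⟩

/-- The start state on an input word `x`: the entries of `x` stand in memory cells
`0, 1, 2, …`; everything else is `0`. -/
def start (x : List ℕ) : State where
  reg := fun _ => 0
  mem := fun i => x.getD i 0

/-- `P` decides the problem `L`, whose instances are presented through `enc`, within cost
`bound`: on every instance it halts, in time, and register `0` tells the answer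
(`1` for yes, `0` for no). -/
def DecidesInTime {α : Type} (P : Prog) (enc : α → List ℕ) (L : α → Prop) (bound : α → ℕ) :
    Prop :=
  ∀ x : α, ∃ (T : ℕ) (s : State), Exec P (start (enc x)) T s ∧ T ≤ bound x ∧
    (L x → s.reg 0 = 1) ∧ (¬ L x → s.reg 0 = 0)

end RAM

/-! ### Neighborhood diversity -/

namespace SimpleGraph

variable {V : Type*}

/-- Two vertices have the same type if `N(u) \ {v} = N(v) \ {u}`. -/
def SameType (G : SimpleGraph V) (u v : V) : Prop :=
  G.neighborSet u \ {v} = G.neighborSet v \ {u}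

/-- A partition of the vertex set into (nonempty) sets of vertices of the same type. -/
def IsTypePartition [Fintype V] [DecidableEq V] (G : SimpleGraph V)
    (P : Finpartition (Finset.univ : Finset V)) : Prop :=
  ∀ A ∈ P.parts, ∀ u ∈ A, ∀ v ∈ A, G.SameType u v

/-- The neighborhood diversity: the least number of sets in a type partition.
(The partition into singletons is a type partition, so the set below is not empty.) -/
noncomputable def neighborhoodDiversity [Fintype V] [DecidableEq V] (G : SimpleGraph V) : ℕ :=
  sInf {t : ℕ | ∃ P : Finpartition (Finset.univ : Finset V),
    G.IsTypePartition P ∧ P.parts.card = t}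

/-- The happy edges of a colored graph: the edges whose endpoints have the same color. -/
def happyEdges {C : Type*} (G : SimpleGraph V) (c : V → C) : Set (Sym2 V) :=
  {e ∈ G.edgeSet | ∀ u ∈ e, ∀ v ∈ e, c u = c v}

end SimpleGraph

/-! ### Maximum Happy Edges -/

/-- An instance of `k`-MHE: a graph on the vertices `0, …, n - 1`, a partial `k`-coloring
(`none` marks the uncolored vertices), and an integer `ℓ`. -/
structure MHEInstance (k : ℕ) where
  n : ℕ
  graph : SimpleGraph (Fin n)
  precolor : Fin n → Option (Fin k)
  ℓ : ℤ

namespace MHEInstance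

variable {k : ℕ}

/-- `c'` is an extended full coloring of the partial coloring. -/
def IsExtension (I : MHEInstance k) (c' : Fin I.n → Fin k) : Prop :=
  ∀ v i, I.precolor v = some i → c' v = i

/-- The question of `k`-MHE: is there an extended full coloring with at least `ℓ` happy edges? -/
def IsYes (I : MHEInstance k) : Prop :=
  ∃ c' : Fin I.n → Fin k, I.IsExtension c' ∧ I.ℓ ≤ ((I.graph.happyEdges c').ncard : ℤ)

open Classical in
/-- An instance as a word of numbers: `n`, the sign (`1` for negative) and the absolute value of
`ℓ`, the colors of the vertices (`0` for uncolored, `i + 1` for the color `i`), and the rows of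
the adjacency matrix. -/
noncomputable def encode (I : MHEInstance k) : List ℕ :=
  [I.n, if I.ℓ < 0 then 1 else 0, I.ℓ.natAbs]
    ++ (List.finRange I.n).map (fun v => (I.precolor v).elim 0 (fun i => (i : ℕ) + 1))
    ++ (List.finRange I.n).flatMap (fun u =>
        (List.finRange I.n).map (fun v => if I.graph.Adj u v then 1 else 0))

end MHEInstance

/-! Giving all uncolored vertices of one type a common, suitably chosen color loses no happy edge:
edges inside this set all become happy, and its members have the same neighbors outside it, so one
color is best for all of them at once (`exists_recolor`). Treating the types in turn, an optimal
coloring may be assumed constant on the uncolored vertices of each type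
(`exists_extension_constant_on_types`). It is then given by a partition of the `t` types into `k`
sets `S_c`, and twice the number of happy edges is a sum over the colors of values `happy c S_c`,
each depending on one set only.

Such a sum is maximized over partitions by inclusion and exclusion. A set `S` gets for color `c` the
weight `W ^ (D * |S| + happy c S)`, where `D` exceeds every total value and `W` the number of tuples
of sets. If `ζ_c` is the subset sum of these weights, then the sum over `S` of `(-1) ^ (t - |S|) * ∏
c, ζ_c S` equals the sum over all covering tuples of the products of their weights
(`sum_coverTuples`). A covering tuple has at least `t` elements in total, and exactly `t` if and
only if it is a partition. Hence division by `W ^ (D * t)` and reduction modulo `W ^ D` isolate the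
partitions, and a comparison with a power of `W` tells whether one of them reaches the target
(`radix_pow_le_iff`). All numbers have polynomially many digits. The transforms are computed one
binary digit at a time, in a table with `k * (t + 1) * 2 ^ t` entries.

The running time is obtained from a calculus of functions computable at a given cost (`Computes`),
closed under arithmetic, memory access and accumulating loops; only the table needs a loop that
writes to memory (`exists_prog_of_table`). The number of types found by the program is at most the
neighborhood diversity, because representatives of different types lie in different parts of every
type partition. -/

/-! ### Polynomially bounded functions -/

/-- `f` is bounded by a polynomial in `σ`. -/
def PolyBdd {α : Type} (σ f : α → ℕ) : Prop :=
  ∃ q : Polynomial ℕ, ∀ a, f a ≤ q.eval (σ a)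

namespace PolyBdd

variable {α β : Type} {σ f g : α → ℕ}

theorem mono (hg : PolyBdd σ g) (h : ∀ a, f a ≤ g a) : PolyBdd σ f :=
  hg.imp fun _ hq a => (h a).trans (hq a)

theorem const (c : ℕ) : PolyBdd σ fun _ => c :=
  ⟨Polynomial.C c, fun a => by simp⟩

theorem self : PolyBdd σ σ :=
  ⟨Polynomial.X, fun a => by simp⟩

theorem add (hf : PolyBdd σ f) (hg : PolyBdd σ g) : PolyBdd σ fun a => f a + g a := by
  obtain ⟨p, hp⟩ := hf
  obtain ⟨q, hq⟩ := hg
  exact ⟨p + q, fun a => by rw [Polynomial.eval_add]; exact add_le_add (hp a) (hq a)⟩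

theorem mul (hf : PolyBdd σ f) (hg : PolyBdd σ g) : PolyBdd σ fun a => f a * g a := by
  obtain ⟨p, hp⟩ := hf
  obtain ⟨q, hq⟩ := hg
  exact ⟨p * q, fun a => by rw [Polynomial.eval_mul]; exact Nat.mul_le_mul (hp a) (hq a)⟩

theorem comp (hf : PolyBdd σ f) (φ : β → α) : PolyBdd (fun b => σ (φ b)) fun b => f (φ b) :=
  hf.imp fun _ hq b => hq (φ b)

end PolyBdd

/-! ### Number of binary digits of sums and products -/

theorem Nat.size_add_le (x y : ℕ) : Nat.size (x + y) ≤ Nat.size x + Nat.size y + 1 := by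
  rw [Nat.size_le]
  have hx := Nat.lt_size_self x
  have hy := Nat.lt_size_self y
  have h1 : 2 ^ Nat.size x ≤ 2 ^ (Nat.size x + Nat.size y) := Nat.pow_le_pow_right (by norm_num) (by omega)
  have h2 : 2 ^ Nat.size y ≤ 2 ^ (Nat.size x + Nat.size y) := Nat.pow_le_pow_right (by norm_num) (by omega)
  rw [pow_succ]
  omega

theorem Nat.size_mul_le (x y : ℕ) : Nat.size (x * y) ≤ Nat.size x + Nat.size y := by
  rw [Nat.size_le, pow_add]
  exact Nat.mul_lt_mul'' (Nat.lt_size_self x) (Nat.lt_size_self y)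

theorem Nat.size_sum_range_le {b : ℕ → ℕ} {n Q : ℕ} (h : ∀ i < n, Nat.size (b i) ≤ Q) :
    Nat.size (∑ i ∈ Finset.range n, b i) ≤ Nat.size n + Q := by
  rcases Nat.eq_zero_or_pos n with rfl | hn
  · simp
  rw [Nat.size_le, pow_add]
  calc ∑ i ∈ Finset.range n, b i ≤ ∑ i ∈ Finset.range n, 2 ^ Q :=
        Finset.sum_le_sum fun i hi => (Nat.size_le.1 (h i (Finset.mem_range.1 hi))).le
    _ = n * 2 ^ Q := by simp
    _ < 2 ^ Nat.size n * 2 ^ Q := Nat.mul_lt_mul_of_pos_right (Nat.lt_size_self n) (by positivity)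

theorem Nat.size_prod_range_le {b : ℕ → ℕ} {n Q : ℕ} (h : ∀ i < n, Nat.size (b i) ≤ Q) :
    Nat.size (∏ i ∈ Finset.range n, b i) ≤ n * Q + 1 := by
  rw [Nat.size_le]
  calc ∏ i ∈ Finset.range n, b i ≤ ∏ i ∈ Finset.range n, 2 ^ Q :=
        Finset.prod_le_prod' fun i hi => (Nat.size_le.1 (h i (Finset.mem_range.1 hi))).le
    _ = 2 ^ (n * Q) := by simp [← pow_mul, mul_comm]
    _ < 2 ^ (n * Q + 1) := Nat.pow_lt_pow_right (by norm_num) (by omega)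

/-! ### Functions computed by programs in a context -/

namespace RAM

theorem Op.size_eval_le (o : Op) (x y : ℕ) :
    Nat.size (o.eval x y) ≤ Nat.size x + Nat.size y + 1 := by
  cases o with
  | add => exact Nat.size_add_le x y
  | sub => exact (Nat.size_le_size (Nat.sub_le x y)).trans (by omega)
  | mul => exact (Nat.size_mul_le x y).trans (by omega)
  | div => exact (Nat.size_le_size (Nat.div_le_self x y)).trans (by omega)

theorem Op.eval_add (x y : ℕ) : Op.add.eval x y = x + y := rfl

theorem Op.eval_sub (x y : ℕ) : Op.sub.eval x y = x - y := rfl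

@[simp] theorem State.setReg_mem (s : State) (d x : ℕ) : (s.setReg d x).mem = s.mem := rfl

@[simp] theorem State.setReg_reg_self (s : State) (d x : ℕ) : (s.setReg d x).reg d = x := by
  simp [State.setReg]

@[simp] theorem State.setReg_reg_of_ne (s : State) {d r : ℕ} (x : ℕ) (h : r ≠ d) :
    (s.setReg d x).reg r = s.reg r := by
  simp [State.setReg, h]

@[simp] theorem State.setMem_reg (s : State) (d x : ℕ) : (s.setMem d x).reg = s.reg := rfl

@[simp] theorem State.setMem_mem (s : State) (d x : ℕ) :
    (s.setMem d x).mem = Function.update s.mem d x := rfl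

/-- A family of machine states: `A a s` says that `s` is a state for the parameter `a`. This
depends only on the memory, which is `M a`, and on the registers below `m`. The numbers in memory
have polynomially many digits in `σ a`. -/
structure Ctx (α : Type) where
  σ : α → ℕ
  A : α → State → Prop
  M : α → ℕ → ℕ
  m : ℕ
  frame : ∀ a s s', A a s → s'.mem = s.mem → (∀ r < m, s'.reg r = s.reg r) → A a s'
  mem_eq : ∀ a s, A a s → s.mem = M a
  mem_size : ∃ q : Polynomial ℕ, ∀ a x, Nat.size (M a x) ≤ q.eval (σ a)
  mem_zero : PolyBdd σ fun a => M a 0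

/-- The context of all states with memory `M a`. -/
def Ctx.ofMem {α : Type} (σ : α → ℕ) (M : α → ℕ → ℕ)
    (hs : ∃ q : Polynomial ℕ, ∀ a x, Nat.size (M a x) ≤ q.eval (σ a))
    (h0 : PolyBdd σ fun a => M a 0) : Ctx α where
  σ := σ
  A a s := s.mem = M a
  M := M
  m := 0
  frame := fun _ _ _ hs hm _ => hm.trans hs
  mem_eq := fun _ _ h => h
  mem_size := hs
  mem_zero := h0

/-- The context in which register `r` moreover holds `x a`. -/
def Ctx.withVar {α : Type} (Γ : Ctx α) (x : α → ℕ) (r : ℕ) (h : Γ.m ≤ r) : Ctx α where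
  σ := Γ.σ
  A a s := Γ.A a s ∧ s.reg r = x a
  M := Γ.M
  m := r + 1
  frame := fun a s s' hs hm hr =>
    ⟨Γ.frame a s s' hs.1 hm fun r' h' => hr r' (by omega), by rw [hr r (by omega), hs.2]⟩
  mem_eq := fun a s hs => Γ.mem_eq a s hs.1
  mem_size := Γ.mem_size
  mem_zero := Γ.mem_zero

def Ctx.comap {α β : Type} (Γ : Ctx α) (φ : β → α) : Ctx β where
  σ b := Γ.σ (φ b)
  A b := Γ.A (φ b)
  M b := Γ.M (φ b)
  m := Γ.m
  frame := fun b => Γ.frame (φ b)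
  mem_eq := fun b => Γ.mem_eq (φ b)
  mem_size := Γ.mem_size.imp fun _ hq b => hq (φ b)
  mem_zero := Γ.mem_zero.comp φ

/-- The context with a loop variable, which is less than `N a`, in register `r`. -/
def Ctx.ext {α : Type} (Γ : Ctx α) (N : α → ℕ) (r : ℕ) (h : Γ.m ≤ r) :
    Ctx (Σ a : α, Fin (N a)) :=
  (Γ.comap Sigma.fst).withVar (fun p => p.2) r h

/-- In the context `Γ` a program computes `f` into any given register above those of the context,
without changing lower registers and memory, at cost `τ` up to a polynomial factor. -/
def Computes {α : Type} (Γ : Ctx α) (τ f : α → ℕ) : Prop :=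
  (PolyBdd Γ.σ fun a => Nat.size (f a)) ∧
  ∀ d, Γ.m ≤ d → ∃ (P : Prog) (q : Polynomial ℕ), ∀ a s, Γ.A a s → ∃ T s', Exec P s T s' ∧
    T ≤ τ a * q.eval (Γ.σ a) ∧ s'.mem = s.mem ∧ (∀ r < d, s'.reg r = s.reg r) ∧ s'.reg d = f a

/-- `f` is computed in polynomial time in the context `Γ`. -/
abbrev PolyTime {α : Type} (Γ : Ctx α) (f : α → ℕ) : Prop :=
  Computes Γ (fun _ => 1) f

/-! ### Closure properties of computable functions -/

section

variable {α : Type} {Γ : Ctx α} {τ f g : α → ℕ}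

theorem Computes.mono {τ' : α → ℕ} (hf : Computes Γ τ f) (h : ∀ a, τ a ≤ τ' a) :
    Computes Γ τ' f := by
  refine ⟨hf.1, fun d hd => ?_⟩
  obtain ⟨P, q, hP⟩ := hf.2 d hd
  refine ⟨P, q, fun a s hs => ?_⟩
  obtain ⟨T, s', h1, h2, h3⟩ := hP a s hs
  exact ⟨T, s', h1, h2.trans (Nat.mul_le_mul_right _ (h a)), h3⟩

/-- A polynomially bounded part of the cost is absorbed into the polynomial factor. In this way a
loop with polynomially many rounds becomes polynomial time. -/
theorem Computes.mul_polyBdd {κ : α → ℕ} (hf : Computes Γ (fun a => τ a * κ a) f)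
    (h : PolyBdd Γ.σ κ) : Computes Γ τ f := by
  refine ⟨hf.1, fun d hd => ?_⟩
  obtain ⟨P, q, hP⟩ := hf.2 d hd
  obtain ⟨p, hp⟩ := h
  refine ⟨P, p * q, fun a s hs => ?_⟩
  obtain ⟨T, s', h1, h2, h3⟩ := hP a s hs
  refine ⟨T, s', h1, h2.trans ?_, h3⟩
  rw [Polynomial.eval_mul, ← mul_assoc]
  exact Nat.mul_le_mul_right _ (Nat.mul_le_mul_left _ (hp a))

theorem Computes.congr (hf : Computes Γ τ f) (h : ∀ a, g a = f a) : Computes Γ τ g := by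
  rwa [show g = f from funext h]

theorem PolyTime.const (c : ℕ) : PolyTime Γ fun _ => c := by
  refine ⟨PolyBdd.const _, fun d hd => ⟨.const d c, Polynomial.C (1 + Nat.size c), fun a s hs =>
    ⟨_, _, Exec.const s d c, by simp, rfl, fun r hr => ?_, by simp⟩⟩⟩
  exact State.setReg_reg_of_ne _ _ hr.ne

theorem PolyTime.var {x : α → ℕ} (hb : PolyBdd Γ.σ fun a => Nat.size (x a)) (r : ℕ)
    (hr : Γ.m ≤ r) : PolyTime (Γ.withVar x r hr) x := by
  refine ⟨hb, fun d hd => ?_⟩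
  obtain ⟨q, hq⟩ := hb
  have hd : r < d := hd
  -- There is no copy instruction, so register `r` is added to zero.
  refine ⟨.seq (.const d 0) (.arith .add d r d), q + Polynomial.C 2, fun p s hs =>
    ⟨_, _, Exec.seq (Exec.const s d 0) (Exec.arith _ .add d r d), ?_, rfl, fun r' h' => ?_, ?_⟩⟩
  · have h1 : Nat.size (x p) ≤ q.eval (Γ.σ p) := hq p
    have h2 := hs.2
    simp [hd.ne, h2, Ctx.withVar]
    omega
  · rw [State.setReg_reg_of_ne _ _ h'.ne, State.setReg_reg_of_ne _ _ h'.ne]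
  · have h2 := hs.2
    simp [hd.ne, h2, Op.eval]

theorem PolyTime.withVar (hf : PolyTime Γ f) (x : α → ℕ) (r : ℕ) (hr : Γ.m ≤ r) :
    PolyTime (Γ.withVar x r hr) f := by
  refine ⟨hf.1, fun d hd => ?_⟩
  obtain ⟨P, q, hP⟩ := hf.2 d (hr.trans ((Nat.le_succ r).trans hd))
  exact ⟨P, q, fun a s hs => hP a s hs.1⟩

theorem PolyTime.comap {β : Type} (hf : PolyTime Γ f) (φ : β → α) :
    PolyTime (Γ.comap φ) fun b => f (φ b) :=
  ⟨hf.1.comp φ, fun d hd => (hf.2 d hd).imp fun _ => Exists.imp fun _ h b => h (φ b)⟩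

theorem PolyTime.loopVar {N : α → ℕ} (hN : PolyBdd Γ.σ fun a => Nat.size (N a)) (r : ℕ)
    (hr : Γ.m ≤ r) : PolyTime (Γ.ext N r hr) fun p => p.2 :=
  PolyTime.var (Γ := Γ.comap Sigma.fst)
    ((hN.comp Sigma.fst).mono fun p => Nat.size_le_size p.2.isLt.le) r hr

theorem PolyTime.lift {N : α → ℕ} (hf : PolyTime Γ f) (r : ℕ) (hr : Γ.m ≤ r) :
    PolyTime (Γ.ext N r hr) fun p => f p.1 :=
  (hf.comap Sigma.fst).withVar _ r hr

/-- The operands are computed into `d` and `d + 1`, the second computation leaving register `d`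
intact. The bound `1 ≤ τ a` pays for the final instruction. -/
theorem Computes.op (o : Op) (hf : Computes Γ τ f) (hg : Computes Γ τ g) (hτ : ∀ a, 1 ≤ τ a) :
    Computes Γ τ fun a => o.eval (f a) (g a) := by
  refine ⟨((hf.1.add hg.1).add (.const 1)).mono fun a => o.size_eval_le _ _, fun d hd => ?_⟩
  obtain ⟨P, q, hP⟩ := hf.2 d hd
  obtain ⟨P', q', hP'⟩ := hg.2 (d + 1) (by omega)
  obtain ⟨u, hu⟩ := hf.1
  obtain ⟨v, hv⟩ := hg.1
  refine ⟨.seq (.seq P P') (.arith o d d (d + 1)), q + q' + (1 + u + v), fun a s hs => ?_⟩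
  obtain ⟨T, s₁, e, hT, hm, hr, hd₁⟩ := hP a s hs
  obtain ⟨T', s₂, e', hT', hm', hr', hd₂⟩ :=
    hP' a s₁ (Γ.frame a s s₁ hs hm fun r h => hr r (by omega))
  refine ⟨_, _, .seq (.seq e e') (.arith s₂ o d d (d + 1)), ?_, hm'.trans hm, fun r h => ?_, ?_⟩
  · rw [hr' d (by omega), hd₁, hd₂]
    have h1 : Nat.size (f a) ≤ _ := hu a
    have h2 : Nat.size (g a) ≤ _ := hv a
    simp only [Polynomial.eval_add, Polynomial.eval_one]
    have h3 := Nat.mul_le_mul_right (1 + u.eval (Γ.σ a) + v.eval (Γ.σ a)) (hτ a)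
    rw [mul_add, mul_add]
    omega
  · rw [State.setReg_reg_of_ne _ _ h.ne, hr' r (by omega), hr r h]
  · rw [State.setReg_reg_self, hr' d (by omega), hd₁, hd₂]

theorem PolyTime.add (hf : PolyTime Γ f) (hg : PolyTime Γ g) : PolyTime Γ fun a => f a + g a :=
  Computes.op .add hf hg fun _ => le_rfl

theorem PolyTime.sub (hf : PolyTime Γ f) (hg : PolyTime Γ g) : PolyTime Γ fun a => f a - g a :=
  Computes.op .sub hf hg fun _ => le_rfl

theorem PolyTime.mul (hf : PolyTime Γ f) (hg : PolyTime Γ g) : PolyTime Γ fun a => f a * g a :=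
  Computes.op .mul hf hg fun _ => le_rfl

theorem PolyTime.div (hf : PolyTime Γ f) (hg : PolyTime Γ g) : PolyTime Γ fun a => f a / g a :=
  Computes.op .div hf hg fun _ => le_rfl

theorem PolyTime.get (hf : PolyTime Γ f) : PolyTime Γ fun a => Γ.M a (f a) := by
  obtain ⟨w, hw⟩ := Γ.mem_size
  refine ⟨⟨w, fun a => hw a _⟩, fun d hd => ?_⟩
  obtain ⟨P, q, hP⟩ := hf.2 d hd
  obtain ⟨u, hu⟩ := hf.1
  refine ⟨.seq P (.load d d), q + (1 + u + w), fun a s hs => ?_⟩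
  obtain ⟨T, s₁, e, hT, hm, hr, hd₁⟩ := hP a s hs
  have hM : s₁.mem = Γ.M a := by rw [hm, Γ.mem_eq a s hs]
  refine ⟨_, _, .seq e (.load s₁ d d), ?_, hm, fun r h => ?_, ?_⟩
  · rw [hd₁, hM]
    have h1 : Nat.size (f a) ≤ _ := hu a
    have h2 := hw a (f a)
    simp only [Polynomial.eval_add, Polynomial.eval_one, one_mul] at hT ⊢
    omega
  · rw [State.setReg_reg_of_ne _ _ h.ne, hr r h]
  · rw [State.setReg_reg_self, hd₁, hM]

/-- A loop that accumulates `b a 0, …, b a (N a - 1)` by the operation `o`. -/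
theorem Computes.fold (o : Op) (c : ℕ) {N : α → ℕ} {b acc : α → ℕ → ℕ} (hN : PolyTime Γ N)
    (hb : ∀ r (hr : Γ.m ≤ r), PolyTime (Γ.ext N r hr) fun p => b p.1 p.2)
    (h0 : ∀ a, acc a 0 = c) (hs : ∀ a, ∀ i < N a, acc a (i + 1) = o.eval (acc a i) (b a i))
    (hacc : ∃ q : Polynomial ℕ, ∀ a, ∀ i ≤ N a, Nat.size (acc a i) ≤ q.eval (Γ.σ a)) :
    Computes Γ (fun a => N a + 1) fun a => acc a (N a) := by
  obtain ⟨w, hw⟩ := hacc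
  refine ⟨⟨w, fun a => hw a _ le_rfl⟩, fun d hd => ?_⟩
  obtain ⟨P, q, hP⟩ := hN.2 (d + 1) (by omega)
  obtain ⟨u, hu⟩ := hN.1
  obtain ⟨B, q', hB⟩ := (hb (d + 2) (by omega)).2 (d + 3) le_rfl
  obtain ⟨v, hv⟩ := (hb (d + 2) (by omega)).1
  -- Register `d` accumulates, `d + 1` counts the remaining rounds, `d + 2` holds the loop variable,
  -- and `d + 3` holds first the new term and then the constant `1`.
  let body : Prog := .seq (.seq (.seq (.seq B (.arith o d d (d + 3))) (.const (d + 3) 1))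
    (.arith .add (d + 2) (d + 2) (d + 3))) (.arith .sub (d + 1) (d + 1) (d + 3))
  -- Per round, `3 * u` pays for the loop test and the two counters, `q'` for the new term, `w + v`
  -- for the accumulation.
  let Q : Polynomial ℕ := 10 + 3 * u + q' + w + v
  have loop : ∀ a, ∀ j ≤ N a, ∀ s, Γ.A a s → s.reg (d + 1) = j → s.reg (d + 2) = N a - j →
      s.reg d = acc a (N a - j) → ∃ T s', Exec (.loop (d + 1) body) s T s' ∧
        T ≤ (j + 1) * Q.eval (Γ.σ a) ∧ s'.mem = s.mem ∧ (∀ r < d, s'.reg r = s.reg r) ∧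
        s'.reg d = acc a (N a) := by
    intro a j
    have hQ : Q.eval (Γ.σ a) = 10 + 3 * u.eval (Γ.σ a) + q'.eval (Γ.σ a) + w.eval (Γ.σ a)
        + v.eval (Γ.σ a) := by
      simp [Q]
    induction j with
    | zero =>
      intro _ s _ h1 _ h3
      refine ⟨_, s, .loop_done h1, ?_, rfl, fun _ _ => rfl, by simpa using h3⟩
      rw [h1]
      simp [hQ]
      omega
    | succ j ih =>
      intro hj s hA h1 h2 h3
      have hi : N a - (j + 1) < N a := by omega
      obtain ⟨T, s₁, e, hT, hm, hr, hd₁⟩ := hB ⟨a, ⟨N a - (j + 1), hi⟩⟩ s ⟨hA, h2⟩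
      have r0 := hr d (by omega)
      have r1 := hr (d + 1) (by omega)
      have r2 := hr (d + 2) (by omega)
      have e' : ∃ T'', Exec body s T'' _ ∧ T'' = _ := ⟨_,
        .seq (.seq (.seq (.seq e (.arith s₁ o d d (d + 3))) (.const _ (d + 3) 1))
          (.arith _ .add (d + 2) (d + 2) (d + 3))) (.arith _ .sub (d + 1) (d + 1) (d + 3)), rfl⟩
      simp [Op.eval_add, Op.eval_sub, r0, r1, r2, h1, h2, h3] at e'
      obtain ⟨T', s', f, hT', hm', hr', hd'⟩ := ih (by omega)
        (((((s₁.setReg d (o.eval (acc a (N a - (j + 1))) (s₁.reg (d + 3)))).setReg (d + 3) 1).setReg (d + 2)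
          (N a - (j + 1) + 1))).setReg (d + 1) j)
        (Γ.frame a s _ hA hm fun r h => by
          have g0 : r ≠ d := by omega
          have g1 : r ≠ d + 1 := by omega
          have g2 : r ≠ d + 2 := by omega
          have g3 : r ≠ d + 3 := by omega
          simp [g0, g1, g2, g3, hr r (by omega)])
        (by simp) (by simp; omega)
        (by
          simp only [State.setReg_reg_self, ne_eq, State.setReg_reg_of_ne, Nat.left_eq_add,
            OfNat.ofNat_ne_zero, one_ne_zero, not_false_eq_true]
          rw [hd₁, show N a - j = N a - (j + 1) + 1 by omega, hs a _ hi])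
      refine ⟨_, s', .loop_step (by omega) e' f, ?_, hm'.trans hm, fun r h => ?_, hd'⟩
      · have g1 := hw a (N a - (j + 1)) hi.le
        have g2 := hv ⟨a, ⟨N a - (j + 1), hi⟩⟩
        have g3 : Nat.size (j + 1) ≤ u.eval (Γ.σ a) := (Nat.size_le_size hj).trans (hu a)
        have g4 : Nat.size (N a - (j + 1)) ≤ u.eval (Γ.σ a) :=
          (Nat.size_le_size hi.le).trans (hu a)
        simp only [Ctx.ext, Ctx.withVar, Ctx.comap] at g2 hT
        have k1 : d ≠ d + 3 := by omega
        simp [h1, hd₁]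
        rw [add_mul (j + 1) 1, one_mul]
        have : Nat.size 1 = 1 := by simp
        omega
      · have g0 : r ≠ d := by omega
        have g1 : r ≠ d + 1 := by omega
        have g2 : r ≠ d + 2 := by omega
        have g3 : r ≠ d + 3 := by omega
        rw [hr' r h]
        simp [g0, g1, g2, g3, hr r (by omega)]
  refine ⟨.seq (.seq (.seq P (.const (d + 2) 0)) (.const d c)) (.loop (d + 1) body),
    q + Polynomial.C (2 + Nat.size c) + Q, fun a s hA => ?_⟩
  obtain ⟨T, s₁, e, hT, hm, hr, hd₁⟩ := hP a s hA
  obtain ⟨T', s', f, hT', hm', hr', hd'⟩ := loop a (N a) le_rfl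
    ((s₁.setReg (d + 2) 0).setReg d c)
    (Γ.frame a s _ hA hm fun r h => by
      have g0 : r ≠ d := by omega
      have g2 : r ≠ d + 2 := by omega
      simp [g0, g2, hr r (by omega)])
    (by simp [hd₁]) (by simp) (by simp [h0])
  refine ⟨_, s', .seq (.seq (.seq e (.const _ (d + 2) 0)) (.const _ d c)) f, ?_, hm'.trans hm,
    fun r h => ?_, hd'⟩
  · simp only [Polynomial.eval_add, Polynomial.eval_C, one_mul] at hT ⊢
    have : Nat.size 0 = 0 := by simp
    rw [add_mul, one_mul] at hT' ⊢
    rw [mul_add]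
    omega
  · have g0 : r ≠ d := by omega
    have g2 : r ≠ d + 2 := by omega
    rw [hr' r h]
    simp [g0, g2, hr r (by omega)]

/-- The number of rounds may be exponential: a polynomial bound on its digits already bounds the
digits of the sum. -/
theorem Computes.sum {N : α → ℕ} {b : α → ℕ → ℕ} (hN : PolyTime Γ N)
    (hb : ∀ r (hr : Γ.m ≤ r), PolyTime (Γ.ext N r hr) fun p => b p.1 p.2) :
    Computes Γ (fun a => N a + 1) fun a => ∑ i ∈ Finset.range (N a), b a i := by
  refine Computes.fold .add 0 (acc := fun a j => ∑ i ∈ Finset.range j, b a i) hN hb (by simp)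
    (fun a i _ => Finset.sum_range_succ _ _) ?_
  obtain ⟨q, hq⟩ := (hb Γ.m le_rfl).1
  obtain ⟨u, hu⟩ := hN.1
  refine ⟨u + q, fun a i hi => ?_⟩
  rw [Polynomial.eval_add]
  exact (Nat.size_sum_range_le fun j hj => hq ⟨a, ⟨j, hj.trans_le hi⟩⟩).trans
    (Nat.add_le_add_right ((Nat.size_le_size hi).trans (hu a)) _)

theorem PolyTime.sum {N : α → ℕ} {b : α → ℕ → ℕ} (hN : PolyTime Γ N) (hN' : PolyBdd Γ.σ N)
    (hb : ∀ r (hr : Γ.m ≤ r), PolyTime (Γ.ext N r hr) fun p => b p.1 p.2) :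
    PolyTime Γ fun a => ∑ i ∈ Finset.range (N a), b a i :=
  ((Computes.sum hN hb).mono fun a => (one_mul (N a + 1)).ge).mul_polyBdd (hN'.add (.const 1))

/-- The digits of a product add up over its factors, so here the number of factors itself has to be
polynomially bounded. -/
theorem PolyTime.prod {N : α → ℕ} {b : α → ℕ → ℕ} (hN : PolyTime Γ N) (hN' : PolyBdd Γ.σ N)
    (hb : ∀ r (hr : Γ.m ≤ r), PolyTime (Γ.ext N r hr) fun p => b p.1 p.2) :
    PolyTime Γ fun a => ∏ i ∈ Finset.range (N a), b a i := by
  have : Computes Γ (fun a => N a + 1) fun a => ∏ i ∈ Finset.range (N a), b a i := by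
    refine Computes.fold .mul 1 (acc := fun a j => ∏ i ∈ Finset.range j, b a i) hN hb (by simp)
      (fun a i _ => Finset.prod_range_succ _ _) ?_
    obtain ⟨q, hq⟩ := (hb Γ.m le_rfl).1
    obtain ⟨u, hu⟩ := hN'
    refine ⟨u * q + 1, fun a i hi => ?_⟩
    rw [Polynomial.eval_add, Polynomial.eval_mul, Polynomial.eval_one]
    exact (Nat.size_prod_range_le fun j hj => hq ⟨a, ⟨j, hj.trans_le hi⟩⟩).trans
      (Nat.add_le_add_right (Nat.mul_le_mul_right _ (hi.trans (hu a))) _)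
  exact (this.mono fun a => (one_mul (N a + 1)).ge).mul_polyBdd (hN'.add (.const 1))

theorem PolyTime.pow (hf : PolyTime Γ f) (hg : PolyTime Γ g) (hg' : PolyBdd Γ.σ g) :
    PolyTime Γ fun a => f a ^ g a :=
  (PolyTime.prod (b := fun a _ => f a) hg hg' fun r hr => hf.lift r hr).congr fun a => by simp

end

/-! ### Filling a table in memory -/

/-- The memory `mem`, with the table entries `V 0, …, V (i - 1)` written from address `base` on. -/
def tableMem (mem : ℕ → ℕ) (base : ℕ) (V : ℕ → ℕ) (i x : ℕ) : ℕ :=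
  if base ≤ x ∧ x < base + i then V (x - base) else mem x

theorem tableMem_zero (mem : ℕ → ℕ) (base : ℕ) (V : ℕ → ℕ) : tableMem mem base V 0 = mem := by
  funext x
  rw [tableMem, if_neg (by omega)]

theorem tableMem_succ (mem : ℕ → ℕ) (base : ℕ) (V : ℕ → ℕ) (i : ℕ) :
    Function.update (tableMem mem base V i) (base + i) (V i) = tableMem mem base V (i + 1) := by
  funext x
  by_cases h : x = base + i
  · subst h
    simp [tableMem]
  · rw [Function.update_of_ne h, tableMem, tableMem]
    exact if_congr (by omega) rfl rfl

theorem tableMem_of_lt {mem : ℕ → ℕ} {base : ℕ} {V : ℕ → ℕ} {i x : ℕ} (h : x < base) :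
    tableMem mem base V i x = mem x := by
  rw [tableMem, if_neg (by omega)]

theorem tableMem_base_add {mem : ℕ → ℕ} {base : ℕ} {V : ℕ → ℕ} {i j : ℕ} (h : j < i) :
    tableMem mem base V i (base + j) = V j := by
  rw [tableMem, if_pos (by omega), Nat.add_sub_cancel_left]

/-- The contexts `Γ₀`, `Γ₁`, `Γ₂` describe the memory before the filling, after some entries, and
after all of them. Since an entry is computed in `Γ₁`, it may be read off from the earlier entries.
The final value is then computed from the full table. -/
theorem exists_prog_of_table {α : Type} {Γ₀ Γ₂ : Ctx α} {N : α → ℕ} {Γ₁ : Ctx (Σ a, Fin (N a))}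
    {base τ f : α → ℕ} {V mem : α → ℕ → ℕ} (hr : Γ₁.m ≤ 1)
    (hA₀ : ∀ a s, s.mem = mem a → Γ₀.A a s)
    (hσ₁ : ∀ p, Γ₁.σ p = Γ₀.σ p.1)
    (hA₁ : ∀ p s, s.mem = tableMem (mem p.1) (base p.1) (V p.1) p.2 → Γ₁.A p s)
    (hσ₂ : ∀ a, Γ₂.σ a = Γ₀.σ a)
    (hA₂ : ∀ a s, s.mem = tableMem (mem a) (base a) (V a) (N a) → Γ₂.A a s)
    (hm₀ : Γ₀.m = 0) (hm₂ : Γ₂.m = 0) (hN : PolyTime Γ₀ N)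
    (hbase : PolyTime (Γ₁.withVar (fun p => p.2) 1 hr) fun p => base p.1 + p.2)
    (hV : PolyTime (Γ₁.withVar (fun p => p.2) 1 hr) fun p => V p.1 p.2)
    (hf : Computes Γ₂ τ f) :
    ∃ (P : Prog) (q : Polynomial ℕ), ∀ a s, s.mem = mem a → ∃ T s', Exec P s T s' ∧
      T ≤ (N a + 1 + τ a) * q.eval (Γ₀.σ a) ∧ s'.reg 0 = f a := by
  obtain ⟨P₀, q₀, h₀⟩ := hN.2 0 hm₀.le
  obtain ⟨P₁, q₁, h₁⟩ := hbase.2 2 le_rfl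
  obtain ⟨P₂, q₂, h₂⟩ := hV.2 3 (Nat.le_succ 2)
  obtain ⟨P₃, q₃, h₃⟩ := hf.2 0 hm₂.le
  obtain ⟨u₀, hu₀⟩ := hN.1
  obtain ⟨u₁, hu₁⟩ := hbase.1
  obtain ⟨u₂, hu₂⟩ := hV.1
  -- Register `0` counts the missing entries, `1` is the position, `2` the address (later the
  -- constant `1`), and `3` the entry.
  let body : Prog := .seq (.seq (.seq (.seq (.seq P₁ P₂) (.store 2 3)) (.const 2 1))
    (.arith .add 1 1 2)) (.arith .sub 0 0 2)
  let Q : Polynomial ℕ := 10 + 3 * u₀ + q₁ + q₂ + u₁ + u₂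
  have loop : ∀ a, ∀ j ≤ N a, ∀ s, s.mem = tableMem (mem a) (base a) (V a) (N a - j) →
      s.reg 0 = j → s.reg 1 = N a - j → ∃ T s', Exec (.loop 0 body) s T s' ∧
        T ≤ (j + 1) * Q.eval (Γ₀.σ a) ∧ s'.mem = tableMem (mem a) (base a) (V a) (N a) := by
    intro a j
    have hQ : Q.eval (Γ₀.σ a) = 10 + 3 * u₀.eval (Γ₀.σ a) + q₁.eval (Γ₀.σ a) + q₂.eval (Γ₀.σ a)
        + u₁.eval (Γ₀.σ a) + u₂.eval (Γ₀.σ a) := by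
      simp [Q]
    induction j with
    | zero =>
      intro _ s hs h1 _
      refine ⟨_, s, .loop_done h1, ?_, hs⟩
      rw [h1]
      simp [hQ]
      omega
    | succ j ih =>
      intro hj s hs k0 k1
      have hi : N a - (j + 1) < N a := by omega
      let p : Σ a, Fin (N a) := ⟨a, ⟨N a - (j + 1), hi⟩⟩
      have hA : (Γ₁.withVar (fun p => p.2) 1 hr).A p s := ⟨hA₁ p s hs, k1⟩
      obtain ⟨T, s₁, e, hT, hm, hr', hd⟩ := h₁ p s hA
      obtain ⟨T', s₂, e', hT', hm', hr'', hd'⟩ :=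
        h₂ p s₁ ((Γ₁.withVar _ 1 hr).frame p s s₁ hA hm hr')
      have r0 : s₂.reg 0 = j + 1 := by rw [hr'' 0 (by omega), hr' 0 (by omega), k0]
      have r1 : s₂.reg 1 = N a - (j + 1) := by rw [hr'' 1 (by omega), hr' 1 (by omega), k1]
      have r2 : s₂.reg 2 = base a + (N a - (j + 1)) := by rw [hr'' 2 (by omega), hd]
      have r3 : s₂.reg 3 = V a (N a - (j + 1)) := hd'
      have e'' : ∃ T'', Exec body s T'' _ ∧ T'' = _ := ⟨_,
        .seq (.seq (.seq (.seq (.seq e e') (.store _ 2 3)) (.const _ 2 1))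
          (.arith _ .add 1 1 2)) (.arith _ .sub 0 0 2), rfl⟩
      simp [Op.eval_add, Op.eval_sub, r0, r1, r2, r3] at e''
      obtain ⟨T₃, s', f, hT₃, hs'⟩ := ih (by omega)
        (((((s₂.setMem (base a + (N a - (j + 1))) (V a (N a - (j + 1)))).setReg 2 1).setReg 1
          (N a - (j + 1) + 1))).setReg 0 j)
        (by
          simp only [State.setReg_mem, State.setMem_mem]
          rw [hm', hm, hs, tableMem_succ]
          congr 1
          omega)
        (by simp) (by simp; omega)
      refine ⟨_, s', .loop_step (by omega) e'' f, ?_, hs'⟩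
      have g0 : Nat.size (j + 1) ≤ u₀.eval (Γ₀.σ a) := (Nat.size_le_size hj).trans (hu₀ a)
      have g1 : Nat.size (N a - (j + 1)) ≤ u₀.eval (Γ₀.σ a) :=
        (Nat.size_le_size hi.le).trans (hu₀ a)
      have g2 : Nat.size (base a + (N a - (j + 1))) ≤ u₁.eval (Γ₀.σ a) := by
        rw [← hσ₁ p]; exact hu₁ p
      have g3 : Nat.size (V a (N a - (j + 1))) ≤ u₂.eval (Γ₀.σ a) := by
        rw [← hσ₁ p]; exact hu₂ p
      simp only [one_mul, Ctx.withVar, hσ₁] at hT hT'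
      have hp : p.1 = a := rfl
      rw [hp] at hT hT'
      rw [k0, add_mul (j + 1) 1, one_mul]
      omega
  refine ⟨.seq (.seq (.seq P₀ (.const 1 0)) (.loop 0 body)) P₃, q₀ + 1 + Q + q₃,
    fun a s hs => ?_⟩
  obtain ⟨T, s₁, e, hT, hm, -, hd⟩ := h₀ a s (hA₀ a s hs)
  obtain ⟨T', s₂, e', hT', hm'⟩ := loop a (N a) le_rfl (s₁.setReg 1 0)
    (by rw [Nat.sub_self, tableMem_zero, State.setReg_mem, hm, hs]) (by simp [hd]) (by simp)
  obtain ⟨T'', s₃, e'', hT'', -, -, hd'⟩ := h₃ a s₂ (hA₂ a s₂ hm')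
  refine ⟨_, s₃, .seq (.seq (.seq e (.const _ 1 0)) e') e'', ?_, hd'⟩
  rw [hσ₂] at hT''
  simp only [Polynomial.eval_add, Polynomial.eval_one, one_mul] at hT ⊢
  have h0 : Nat.size 0 = 0 := by simp
  rw [h0]
  calc T + (1 + 0) + T' + T''
      ≤ q₀.eval (Γ₀.σ a) + 1 + (N a + 1) * Q.eval (Γ₀.σ a) + τ a * q₃.eval (Γ₀.σ a) := by omega
    _ ≤ _ := by
      generalize q₀.eval (Γ₀.σ a) = x
      generalize q₃.eval (Γ₀.σ a) = y
      generalize Q.eval (Γ₀.σ a) = z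
      have := Nat.zero_le (N a * x + N a + τ a * x + τ a + τ a * z + N a * y + y)
      linarith [show (N a + 1 + τ a) * (x + 1 + z + y) = (x + 1 + (N a + 1) * z + τ a * y) +
        (N a * x + N a + τ a * x + τ a + τ a * z + N a * y + y) by ring]

end RAM

/-! ### The algorithm, as functions on memories -/

namespace HappyEdges

/-- `1` if `x = y`, else `0`. -/
def isEq (x y : ℕ) : ℕ := 1 - (x - y + (y - x))

/-- Digit `j` of the binary number `S`. -/
def bit (S j : ℕ) : ℕ := S / 2 ^ j % 2

/-- The entry of the adjacency matrix. -/
def adj (M : ℕ → ℕ) (u v : ℕ) : ℕ := 1 - (1 - M (3 + M 0 + (M 0 * u + v)))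

/-- `1` if `u` and `v` have the same type, else `0`. -/
def sameType (M : ℕ → ℕ) (u v : ℕ) : ℕ :=
  1 - ∑ w ∈ Finset.range (M 0),
    (1 - isEq w u) * ((1 - isEq w v) * (1 - isEq (adj M u w) (adj M v w)))

/-- `1` if `v` is the first vertex of its type, else `0`. -/
def isRep (M : ℕ → ℕ) (v : ℕ) : ℕ := ∏ u ∈ Finset.range v, (1 - sameType M u v)

def typeCount (M : ℕ → ℕ) : ℕ := ∑ v ∈ Finset.range (M 0), isRep M v

/-- The number of the type of `v`: how many types begin before that of `v`. -/
def typeId (M : ℕ → ℕ) (v : ℕ) : ℕ :=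
  ∑ w ∈ Finset.range (M 0), isRep M w * ∏ u ∈ Finset.range (w + 1), (1 - sameType M u v)

/-- `1` if `u` has the color `c` when the uncolored vertices of the types in `S` get the
color `c`, else `0`. -/
def inClass (M : ℕ → ℕ) (c S u : ℕ) : ℕ :=
  isEq (M (3 + u)) (c + 1) + isEq (M (3 + u)) 0 * bit S (typeId M u)

/-- Twice the number of edges of color `c` when the uncolored vertices of the types in `S` get the
color `c`. -/
def happy (M : ℕ → ℕ) (c S : ℕ) : ℕ :=
  ∑ u ∈ Finset.range (M 0), ∑ v ∈ Finset.range (M 0),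
    adj M u v * (inClass M c S u * inClass M c S v)

def popcount (M : ℕ → ℕ) (S : ℕ) : ℕ := ∑ j ∈ Finset.range (typeCount M), bit S j

/-- Exceeds the number `2 ^ (t * k)` of tuples of sets of types, so a sum of powers over tuples
produces no carries. -/
def radix (k : ℕ) (M : ℕ → ℕ) : ℕ := 2 ^ (M 0 * k + 1)

/-- Exceeds the sum of the values `happy` over the `k` colors, each of which is at most the squared
number of vertices. -/
def valueBound (k : ℕ) (M : ℕ → ℕ) : ℕ := k * (M 0 * M 0) + 1

/-- The exponent is a two-digit number in base `valueBound`, with the size of the set above its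
value. Multiplying weights adds sizes and values separately. -/
def weight (k : ℕ) (M : ℕ → ℕ) (c S : ℕ) : ℕ :=
  radix k M ^ (valueBound k M * popcount M S + happy M c S)

/-- The first cell after the input word. -/
def tableBase (M : ℕ → ℕ) : ℕ := 3 + M 0 + M 0 * M 0

def tableSize (k : ℕ) (M : ℕ → ℕ) : ℕ := k * (typeCount M + 1) * 2 ^ typeCount M

/-- The position in the table of the zeta transform of the weights for color `c`, carried out up
to digit `j`, at the set `S`. -/
def index (M : ℕ → ℕ) (c j S : ℕ) : ℕ :=
  (c * (typeCount M + 1) + j) * 2 ^ typeCount M + S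

/-- The table entry at position `i`, computed from earlier ones. -/
def entry (k : ℕ) (M : ℕ → ℕ) (i : ℕ) : ℕ :=
  (1 - i / 2 ^ typeCount M % (typeCount M + 1)) *
      weight k M (i / 2 ^ typeCount M / (typeCount M + 1)) (i % 2 ^ typeCount M) +
    (1 - (1 - i / 2 ^ typeCount M % (typeCount M + 1))) *
      (M (tableBase M + i - 2 ^ typeCount M) +
        bit (i % 2 ^ typeCount M) (i / 2 ^ typeCount M % (typeCount M + 1) - 1) *
          M (tableBase M + i - 2 ^ typeCount M -
            2 ^ (i / 2 ^ typeCount M % (typeCount M + 1) - 1)))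

/-- The product of the finished transforms at `S`. -/
def product (k : ℕ) (M : ℕ → ℕ) (S : ℕ) : ℕ :=
  ∏ c ∈ Finset.range k, M (tableBase M + index M c (typeCount M) S)

/-- The alternating sum of the products. -/
def total (k : ℕ) (M : ℕ → ℕ) : ℕ :=
  ∑ S ∈ Finset.range (2 ^ typeCount M), (1 - (typeCount M - popcount M S) % 2) * product k M S -
    ∑ S ∈ Finset.range (2 ^ typeCount M), (typeCount M - popcount M S) % 2 * product k M S

/-- The threshold is doubled, as `happy` counts edges twice, and replaced by `0` if negative. The
cap `valueBound`, which no coloring attains, keeps `radix ^ target` polynomially long. -/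
def target (k : ℕ) (M : ℕ → ℕ) : ℕ :=
  (1 - M 1) * (2 * M 2 - (2 * M 2 - valueBound k M))

/-- Truncated subtraction serves as comparison: the value is `1` exactly when the extracted block of
digits is at least `radix ^ target`. -/
def answer (k : ℕ) (M : ℕ → ℕ) : ℕ :=
  1 - (radix k M ^ target k M -
    total k M / radix k M ^ (valueBound k M * typeCount M) % radix k M ^ valueBound k M)

/-! ### Bounds -/

theorem isEq_eq (x y : ℕ) : isEq x y = if x = y then 1 else 0 := by
  unfold isEq
  split_ifs <;> omega

theorem bit_eq (S j : ℕ) : bit S j = if S.testBit j then 1 else 0 := by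
  rw [bit, Nat.testBit_eq_decide_div_mod_eq]
  have := Nat.mod_two_eq_zero_or_one (S / 2 ^ j)
  rcases this with h | h <;> simp [h]

theorem bit_le_one (S j : ℕ) : bit S j ≤ 1 :=
  Nat.lt_succ_iff.1 (Nat.mod_lt _ two_pos)

theorem adj_le_one (M : ℕ → ℕ) (u v : ℕ) : adj M u v ≤ 1 :=
  Nat.sub_le _ _

theorem isRep_le_one (M : ℕ → ℕ) (v : ℕ) : isRep M v ≤ 1 :=
  Finset.prod_le_one' fun _ _ => Nat.sub_le _ _

theorem typeCount_le (M : ℕ → ℕ) : typeCount M ≤ M 0 :=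
  (Finset.sum_le_card_nsmul _ _ 1 fun _ _ => isRep_le_one M _).trans (by simp)

theorem typeId_le (M : ℕ → ℕ) (v : ℕ) : typeId M v ≤ M 0 :=
  (Finset.sum_le_card_nsmul _ _ 1 fun w _ => (Nat.mul_le_mul (isRep_le_one M w)
    (Finset.prod_le_one' fun _ _ => Nat.sub_le _ _)).trans le_rfl).trans (by simp)

theorem inClass_le_one (M : ℕ → ℕ) (c S u : ℕ) : inClass M c S u ≤ 1 := by
  have := bit_le_one S (typeId M u)
  rw [inClass, isEq_eq, isEq_eq]
  split_ifs <;> omega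

theorem happy_le (M : ℕ → ℕ) (c S : ℕ) : happy M c S ≤ M 0 * M 0 := by
  refine (Finset.sum_le_card_nsmul _ _ (M 0) fun u _ => ?_).trans (by simp)
  refine (Finset.sum_le_card_nsmul _ _ 1 fun v _ => ?_).trans (by simp)
  exact Nat.mul_le_mul (adj_le_one M u v)
    (Nat.mul_le_mul (inClass_le_one M c S u) (inClass_le_one M c S v))

theorem popcount_le (M : ℕ → ℕ) (S : ℕ) : popcount M S ≤ typeCount M :=
  (Finset.sum_le_card_nsmul _ _ 1 fun _ _ => bit_le_one S _).trans (by simp)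

/-! ### Running times -/

open RAM

section

variable {α : Type} {Γ : Ctx α} {f g u v : α → ℕ}

theorem polyTime_mod (hf : PolyTime Γ f) (hg : PolyTime Γ g) : PolyTime Γ fun a => f a % g a :=
  (hf.sub (hg.mul (hf.div hg))).congr fun _ => by
    rw [Nat.mod_eq_sub_mul_div]

theorem polyTime_isEq (hf : PolyTime Γ f) (hg : PolyTime Γ g) :
    PolyTime Γ fun a => isEq (f a) (g a) :=
  (PolyTime.const 1).sub ((hf.sub hg).add (hg.sub hf))

theorem polyTime_bit (hf : PolyTime Γ f) (hg : PolyTime Γ g) (hg' : PolyBdd Γ.σ g) :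
    PolyTime Γ fun a => bit (f a) (g a) :=
  polyTime_mod (hf.div ((PolyTime.const 2).pow hg hg')) (.const 2)

theorem polyTime_zero : PolyTime Γ fun a => Γ.M a 0 :=
  (PolyTime.const 0).get

theorem polyTime_adj (hu : PolyTime Γ u) (hv : PolyTime Γ v) :
    PolyTime Γ fun a => adj (Γ.M a) (u a) (v a) :=
  (PolyTime.const 1).sub ((PolyTime.const 1).sub
    (((PolyTime.const 3).add polyTime_zero).add ((polyTime_zero.mul hu).add hv)).get)

theorem polyTime_sameType (hu : PolyTime Γ u) (hv : PolyTime Γ v) :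
    PolyTime Γ fun a => sameType (Γ.M a) (u a) (v a) := by
  refine (PolyTime.const 1).sub (PolyTime.sum polyTime_zero Γ.mem_zero fun r hr => ?_)
  have hw := PolyTime.loopVar (Γ := Γ) (polyTime_zero).1 r hr
  exact ((PolyTime.const 1).sub (polyTime_isEq hw (hu.lift r hr))).mul
    (((PolyTime.const 1).sub (polyTime_isEq hw (hv.lift r hr))).mul
      ((PolyTime.const 1).sub (polyTime_isEq (polyTime_adj (hu.lift r hr) hw)
        (polyTime_adj (hv.lift r hr) hw))))

theorem polyTime_isRep (hv : PolyTime Γ v) (hv' : PolyBdd Γ.σ v) :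
    PolyTime Γ fun a => isRep (Γ.M a) (v a) := by
  refine PolyTime.prod hv hv' fun r hr => ?_
  exact (PolyTime.const 1).sub (polyTime_sameType (PolyTime.loopVar hv.1 r hr) (hv.lift r hr))

theorem loopVar_polyBdd {N : α → ℕ} (hN : PolyBdd Γ.σ N) (r : ℕ) (hr : Γ.m ≤ r) :
    PolyBdd (Γ.ext N r hr).σ fun p => p.2 :=
  (hN.comp Sigma.fst).mono fun p => p.2.isLt.le

theorem polyTime_typeCount : PolyTime Γ fun a => typeCount (Γ.M a) :=
  PolyTime.sum polyTime_zero Γ.mem_zero fun r hr =>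
    polyTime_isRep (PolyTime.loopVar polyTime_zero.1 r hr) (loopVar_polyBdd Γ.mem_zero r hr)

theorem polyBdd_typeCount : PolyBdd Γ.σ fun a => typeCount (Γ.M a) :=
  Γ.mem_zero.mono fun _ => typeCount_le _

theorem polyTime_typeId (hv : PolyTime Γ v) : PolyTime Γ fun a => typeId (Γ.M a) (v a) := by
  refine PolyTime.sum polyTime_zero Γ.mem_zero fun r hr => ?_
  have hw := PolyTime.loopVar (Γ := Γ) (polyTime_zero).1 r hr
  have hw' := loopVar_polyBdd Γ.mem_zero r hr
  refine (polyTime_isRep hw hw').mul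
    (PolyTime.prod (hw.add (.const 1)) (hw'.add (.const 1)) fun r' hr' => ?_)
  exact (PolyTime.const 1).sub (polyTime_sameType
    (PolyTime.loopVar (hw.add (.const 1)).1 r' hr') ((hv.lift r hr).lift r' hr'))

theorem polyTime_inClass (hf : PolyTime Γ f) (hg : PolyTime Γ g) (hu : PolyTime Γ u) :
    PolyTime Γ fun a => inClass (Γ.M a) (f a) (g a) (u a) := by
  have hc := ((PolyTime.const 3).add hu).get
  exact (polyTime_isEq hc (hf.add (.const 1))).add ((polyTime_isEq hc (.const 0)).mul
    (polyTime_bit hg (polyTime_typeId hu) (Γ.mem_zero.mono fun _ => typeId_le _ _)))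

theorem polyTime_happy (hf : PolyTime Γ f) (hg : PolyTime Γ g) :
    PolyTime Γ fun a => happy (Γ.M a) (f a) (g a) := by
  refine PolyTime.sum polyTime_zero Γ.mem_zero fun r hr => ?_
  have hu := PolyTime.loopVar (Γ := Γ) (polyTime_zero).1 r hr
  refine PolyTime.sum (polyTime_zero (Γ := Γ.ext _ r hr)) (Ctx.mem_zero _) fun r' hr' => ?_
  have hv := PolyTime.loopVar (Γ := Γ.ext _ r hr) (polyTime_zero).1 r' hr'
  have hu' := hu.lift (N := fun p => Γ.M p.1 0) r' hr'
  have hf' := (hf.lift (N := fun a => Γ.M a 0) r hr).lift (N := fun p => Γ.M p.1 0) r' hr'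
  have hg' := (hg.lift (N := fun a => Γ.M a 0) r hr).lift (N := fun p => Γ.M p.1 0) r' hr'
  exact (polyTime_adj hu' hv).mul
    ((polyTime_inClass hf' hg' hu').mul (polyTime_inClass hf' hg' hv))

theorem polyTime_popcount (hf : PolyTime Γ f) : PolyTime Γ fun a => popcount (Γ.M a) (f a) :=
  PolyTime.sum polyTime_typeCount polyBdd_typeCount fun r hr =>
    polyTime_bit (hf.lift r hr) (PolyTime.loopVar polyTime_typeCount.1 r hr)
      (loopVar_polyBdd polyBdd_typeCount r hr)

theorem polyTime_radix (k : ℕ) : PolyTime Γ fun a => radix k (Γ.M a) :=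
  (PolyTime.const 2).pow ((polyTime_zero.mul (.const k)).add (.const 1))
    ((Γ.mem_zero.mul (.const k)).add (.const 1))

theorem polyTime_valueBound (k : ℕ) : PolyTime Γ fun a => valueBound k (Γ.M a) :=
  ((PolyTime.const k).mul (polyTime_zero.mul polyTime_zero)).add (.const 1)

theorem polyBdd_valueBound (k : ℕ) : PolyBdd Γ.σ fun a => valueBound k (Γ.M a) :=
  ((PolyBdd.const k).mul (Γ.mem_zero.mul Γ.mem_zero)).add (.const 1)

/-- Although the weight is huge, its exponent is polynomially bounded, hence so is its number of
digits. -/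
theorem polyTime_weight (k : ℕ) (hf : PolyTime Γ f) (hg : PolyTime Γ g) :
    PolyTime Γ fun a => weight k (Γ.M a) (f a) (g a) := by
  refine (polyTime_radix k).pow
    (((polyTime_valueBound k).mul (polyTime_popcount hg)).add (polyTime_happy hf hg)) ?_
  exact (((polyBdd_valueBound k).mul polyBdd_typeCount).add (Γ.mem_zero.mul Γ.mem_zero)).mono
    fun a => add_le_add (Nat.mul_le_mul_left _ (popcount_le _ _)) (happy_le _ _ _)

theorem polyTime_tableBase : PolyTime Γ fun a => tableBase (Γ.M a) :=
  ((PolyTime.const 3).add polyTime_zero).add (polyTime_zero.mul polyTime_zero)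

theorem polyTime_numSets : PolyTime Γ fun a => 2 ^ typeCount (Γ.M a) :=
  (PolyTime.const 2).pow polyTime_typeCount polyBdd_typeCount

theorem polyTime_tableSize (k : ℕ) : PolyTime Γ fun a => tableSize k (Γ.M a) :=
  ((PolyTime.const k).mul (polyTime_typeCount.add (.const 1))).mul polyTime_numSets

theorem polyTime_entry (k : ℕ) (hf : PolyTime Γ f) :
    PolyTime Γ fun a => entry k (Γ.M a) (f a) := by
  have hq := hf.div polyTime_numSets
  have ht : PolyTime Γ fun a => typeCount (Γ.M a) + 1 := polyTime_typeCount.add (.const 1)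
  have hj := polyTime_mod hq ht
  have hj' := hj.sub (.const 1)
  have hb : PolyBdd Γ.σ fun a =>
      f a / 2 ^ typeCount (Γ.M a) % (typeCount (Γ.M a) + 1) - 1 :=
    polyBdd_typeCount.mono fun a =>
      (Nat.sub_le _ _).trans (Nat.lt_succ_iff.1 (Nat.mod_lt _ (Nat.succ_pos _)))
  have hS := polyTime_mod hf polyTime_numSets
  have hp := (polyTime_tableBase.add hf).sub polyTime_numSets
  exact (((PolyTime.const 1).sub hj).mul (polyTime_weight k (hq.div ht) hS)).add
    (((PolyTime.const 1).sub ((PolyTime.const 1).sub hj)).mul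
      (hp.get.add ((polyTime_bit hS hj' hb).mul
        (hp.sub ((PolyTime.const 2).pow hj' hb)).get)))

theorem polyTime_product (k : ℕ) (hf : PolyTime Γ f) :
    PolyTime Γ fun a => product k (Γ.M a) (f a) := by
  refine PolyTime.prod (.const k) (.const k) fun r hr => ?_
  have hc := PolyTime.loopVar (Γ := Γ) (PolyTime.const k).1 r hr
  exact (polyTime_tableBase.add ((((hc.mul (polyTime_typeCount.add (.const 1))).add
    polyTime_typeCount).mul polyTime_numSets).add (hf.lift r hr))).get

/-- Once the table is filled, this is the only exponentially long computation: `2 ^ t` terms, each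
of polynomial cost. -/
theorem computes_total (k : ℕ) :
    Computes Γ (fun a => 2 ^ typeCount (Γ.M a) + 1) fun a => total k (Γ.M a) := by
  refine Computes.op .sub
    (Computes.sum
      (b := fun a S => (1 - (typeCount (Γ.M a) - popcount (Γ.M a) S) % 2) * product k (Γ.M a) S)
      polyTime_numSets fun r hr => ?_)
    (Computes.sum
      (b := fun a S => (typeCount (Γ.M a) - popcount (Γ.M a) S) % 2 * product k (Γ.M a) S)
      polyTime_numSets fun r hr => ?_) fun _ => Nat.le_add_left _ _
  all_goals
    have hS := PolyTime.loopVar (Γ := Γ) polyTime_numSets.1 r hr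
    have hpar := polyTime_mod (polyTime_typeCount.sub (polyTime_popcount hS)) (.const 2)
  · exact ((PolyTime.const 1).sub hpar).mul (polyTime_product k hS)
  · exact hpar.mul (polyTime_product k hS)

theorem polyTime_target (k : ℕ) : PolyTime Γ fun a => target k (Γ.M a) := by
  have h := (PolyTime.const (Γ := Γ) 2).mul (PolyTime.const 2).get
  exact ((PolyTime.const 1).sub (PolyTime.const 1).get).mul
    (h.sub (h.sub (polyTime_valueBound k)))

theorem target_le (k : ℕ) (M : ℕ → ℕ) : target k M ≤ valueBound k M := by
  refine (Nat.mul_le_mul_right _ (Nat.sub_le 1 (M 1))).trans ?_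
  omega

theorem computes_answer (k : ℕ) :
    Computes Γ (fun a => 2 ^ typeCount (Γ.M a) + 1) fun a => answer k (Γ.M a) := by
  have hτ : ∀ a, 1 ≤ 2 ^ typeCount (Γ.M a) + 1 := fun _ => Nat.le_add_left _ _
  have hW := (polyTime_radix (Γ := Γ) k).pow (polyTime_valueBound k) (polyBdd_valueBound k)
  have hZ := (polyTime_radix (Γ := Γ) k).pow ((polyTime_valueBound k).mul polyTime_typeCount)
    ((polyBdd_valueBound k).mul polyBdd_typeCount)
  have ht := (polyTime_radix (Γ := Γ) k).pow (polyTime_target k)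
    ((polyBdd_valueBound k).mono fun a => target_le k _)
  have hq := Computes.op .div (computes_total k) (hZ.mono hτ) hτ
  -- The remainder is expressed by division, multiplication and subtraction, as the machine has no
  -- instruction for it.
  have hm := Computes.op .sub hq (Computes.op .mul (hW.mono hτ)
    (Computes.op .div hq (hW.mono hτ) hτ) hτ) hτ
  refine (Computes.op .sub ((PolyTime.const 1).mono hτ)
    (Computes.op .sub (ht.mono hτ) hm hτ) hτ).congr fun a => ?_
  simp only [answer, Op.eval, Nat.mod_eq_sub_mul_div]

end

end HappyEdges

namespace HappyEdges

/-! ### Covering tuples of sets, counted by inclusion and exclusion -/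

open Finset

/-- The set with indicator number `S`, as a subset of `{0, …, t - 1}`. -/
def bits (t S : ℕ) : Finset ℕ := {j ∈ range t | S.testBit j}

theorem mem_bits {t S j : ℕ} : j ∈ bits t S ↔ j < t ∧ S.testBit j := by
  simp [bits]

theorem bits_subset (t S : ℕ) : bits t S ⊆ range t := filter_subset _ _

theorem sum_bit (t S : ℕ) : ∑ j ∈ range t, bit S j = #(bits t S) := by
  simp [bits, bit_eq]

theorem bits_injOn (t : ℕ) : Set.InjOn (bits t) (range (2 ^ t)) := by
  intro S hS T hT h
  simp only [coe_range, Set.mem_Iio] at hS hT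
  refine Nat.eq_of_testBit_eq fun j => ?_
  rcases lt_or_ge j t with hj | hj
  · have : j ∈ bits t S ↔ j ∈ bits t T := by rw [h]
    rw [mem_bits, mem_bits] at this
    exact Bool.eq_iff_iff.2 (by tauto)
  · have h2 : 2 ^ t ≤ 2 ^ j := Nat.pow_le_pow_right two_pos hj
    rw [Nat.testBit_eq_false_of_lt (hS.trans_le h2), Nat.testBit_eq_false_of_lt (hT.trans_le h2)]

theorem image_bits (t : ℕ) : (range (2 ^ t)).image (bits t) = (range t).powerset := by
  refine eq_of_subset_of_card_le (fun A hA => ?_) ?_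
  · obtain ⟨S, -, rfl⟩ := mem_image.1 hA
    exact mem_powerset.2 (bits_subset t S)
  · rw [card_image_of_injOn (bits_injOn t)]
    simp

theorem sum_bits {R : Type*} [AddCommMonoid R] (t : ℕ) (φ : Finset ℕ → R) :
    ∑ S ∈ range (2 ^ t), φ (bits t S) = ∑ A ∈ (range t).powerset, φ A := by
  rw [← image_bits, sum_image (bits_injOn t)]

theorem exists_bits_eq {t : ℕ} {A : Finset ℕ} (hA : A ⊆ range t) :
    ∃ S < 2 ^ t, bits t S = A := by
  have : A ∈ (range (2 ^ t)).image (bits t) := by rw [image_bits]; exact mem_powerset.2 hA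
  obtain ⟨S, hS, h⟩ := mem_image.1 this
  exact ⟨S, mem_range.1 hS, h⟩

/-- The zeta transform of `g` over the subset lattice, carried out for the digits below `j`. -/
def zeta (g : ℕ → ℕ) : ℕ → ℕ → ℕ
  | 0, S => g S
  | j + 1, S => zeta g j S + bit S j * zeta g j (S - 2 ^ j)

theorem two_pow_le_of_testBit {S j : ℕ} (h : S.testBit j) : 2 ^ j ≤ S :=
  Nat.ge_two_pow_of_testBit h

/-- Subtracting `2 ^ j` when digit `j` is set causes no borrow: it removes the element `j` from the
set, as the recursion of `zeta` requires. -/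
theorem testBit_sub_two_pow {S j : ℕ} (h : S.testBit j) (i : ℕ) :
    (S - 2 ^ j).testBit i = (decide (i ≠ j) && S.testBit i) := by
  obtain ⟨x, rfl⟩ := Nat.exists_eq_add_of_le (two_pow_le_of_testBit h)
  rw [Nat.add_sub_cancel_left]
  rw [Nat.testBit_two_pow_add_eq, Bool.not_eq_true'] at h
  rcases lt_trichotomy i j with hi | rfl | hi
  · rw [Nat.testBit_two_pow_add_gt hi]
    simp [hi.ne]
  · simp [h]
  · obtain ⟨e, rfl⟩ : ∃ e, i = e + (j + 1) := ⟨i - (j + 1), by omega⟩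
    rw [← Nat.testBit_div_two_pow, ← Nat.testBit_div_two_pow]
    have h1 : x / 2 ^ j % 2 = 0 := by
      have := bit_eq x j
      rw [bit] at this
      simpa [h] using this
    rw [pow_succ, ← Nat.div_div_eq_div_mul, ← Nat.div_div_eq_div_mul,
      Nat.add_div_left x (by positivity)]
    rw [show (x / 2 ^ j).succ / 2 = x / 2 ^ j / 2 by omega]
    simp [hi.ne']

-- Stage `j` frees digit `j`. If `j` lies in `S`, the sets `T` containing `j` come from the previous
-- sum at `S`, those avoiding `j` from the one at `S` without `j`; otherwise nothing changes.
open Classical in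
theorem zeta_eq_sum (g : ℕ → ℕ) {t j S : ℕ} (hj : j ≤ t) (hS : S < 2 ^ t) :
    zeta g j S = ∑ T ∈ range (2 ^ t) with
      (∀ i < j, T.testBit i → S.testBit i) ∧ ∀ i, j ≤ i → T.testBit i = S.testBit i, g T := by
  induction j generalizing S with
  | zero =>
    rw [zeta, sum_eq_single_of_mem S (by simp [hS])]
    intro T hT hne
    simp only [mem_filter] at hT
    exact absurd (Nat.eq_of_testBit_eq fun i => hT.2.2 i (Nat.zero_le i)) hne
  | succ j ih =>
    rw [zeta, bit_eq, ih (by omega) hS]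
    split_ifs with hb
    · rw [one_mul, ih (by omega) ((Nat.sub_le _ _).trans_lt hS), ← sum_union]
      · refine sum_congr ?_ fun _ _ => rfl
        ext T
        simp only [mem_union, mem_filter, testBit_sub_two_pow hb]
        constructor
        · rintro (⟨h1, h2, h3⟩ | ⟨h1, h2, h3⟩)
          · refine ⟨h1, fun i hi h => ?_, fun i hi => h3 i (by omega)⟩
            rcases Nat.lt_succ_iff_lt_or_eq.1 hi with hi | rfl
            · exact h2 i hi h
            · exact hb
          · refine ⟨h1, fun i hi h => ?_, fun i hi => ?_⟩
            · rcases Nat.lt_succ_iff_lt_or_eq.1 hi with hi | rfl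
              · have := h2 i hi h
                simp_all
              · exact hb
            · rw [h3 i (by omega)]
              simp [show i ≠ j by omega]
        · rintro ⟨h1, h2, h3⟩
          by_cases hT : T.testBit j
          · refine .inl ⟨h1, fun i hi => h2 i (by omega), fun i hi => ?_⟩
            rcases hi.eq_or_lt with rfl | hi
            · rw [hT, hb]
            · exact h3 i hi
          · refine .inr ⟨h1, fun i hi h => ?_, fun i hi => ?_⟩
            · simp [h2 i (by omega) h, hi.ne]
            · rcases hi.eq_or_lt with rfl | hi
              · simpa using hT
              · rw [h3 i hi]
                simp [hi.ne']
      · rw [disjoint_left]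
        intro T h1 h2
        have h1 := (mem_filter.1 h1).2.2 j le_rfl
        have h2 := (mem_filter.1 h2).2.2 j le_rfl
        rw [testBit_sub_two_pow hb, h1, hb] at h2
        simp at h2
    · rw [zero_mul, add_zero]
      refine sum_congr (filter_congr fun T _ => ?_) fun _ _ => rfl
      constructor
      · rintro ⟨h2, h3⟩
        refine ⟨fun i hi h => ?_, fun i hi => h3 i (by omega)⟩
        rcases Nat.lt_succ_iff_lt_or_eq.1 hi with hi | rfl
        · exact h2 i hi h
        · rwa [h3 i le_rfl] at h
      · rintro ⟨h2, h3⟩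
        refine ⟨fun i hi => h2 i (by omega), fun i hi => ?_⟩
        rcases hi.eq_or_lt with rfl | hi
        · have := h2 j (by omega)
          simp only [Bool.not_eq_true] at hb
          rw [hb] at this ⊢
          simpa using this
        · exact h3 i hi

open Classical in
theorem zeta_eq_sum_subset (g : ℕ → ℕ) {t S : ℕ} (hS : S < 2 ^ t) :
    zeta g t S = ∑ T ∈ range (2 ^ t) with bits t T ⊆ bits t S, g T := by
  rw [zeta_eq_sum g le_rfl hS]
  refine sum_congr (filter_congr fun T hT => ?_) fun _ _ => rfl
  rw [mem_range] at hT
  constructor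
  · rintro ⟨h, -⟩ i hi
    rw [mem_bits] at hi ⊢
    exact ⟨hi.1, h i hi.1 hi.2⟩
  · refine fun h => ⟨fun i hi hb => (mem_bits.1 (h (mem_bits.2 ⟨hi, hb⟩))).2, fun i hi => ?_⟩
    have h2 : 2 ^ t ≤ 2 ^ i := Nat.pow_le_pow_right two_pos hi
    rw [Nat.testBit_eq_false_of_lt (hS.trans_le h2), Nat.testBit_eq_false_of_lt (hT.trans_le h2)]

theorem zeta_le {g : ℕ → ℕ} {B : ℕ} (h : ∀ S, g S ≤ B) (j S : ℕ) : zeta g j S ≤ 2 ^ j * B := by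
  induction j generalizing S with
  | zero => simpa [zeta] using h S
  | succ j ih =>
    rw [zeta, pow_succ]
    have := Nat.mul_le_mul (bit_le_one S j) (ih (S - 2 ^ j))
    have := ih S
    linarith

/-- The complements of the sets `A ⊇ U` are all the subsets of the complement of `U`, and the
alternating sum over the subsets of a nonempty set vanishes. -/
theorem sum_neg_one_pow_superset {t : ℕ} {U : Finset ℕ} (hU : U ⊆ range t) :
    ∑ A ∈ (range t).powerset, (if U ⊆ A then (-1 : ℤ) ^ (t - #A) else 0) =
      if U = range t then 1 else 0 := by
  have h1 : ∑ A ∈ (range t).powerset, (if U ⊆ A then (-1 : ℤ) ^ (t - #A) else 0) =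
      ∑ B ∈ (range t \ U).powerset, (-1 : ℤ) ^ #B := by
    rw [← sum_filter]
    refine sum_bij' (fun A _ => range t \ A) (fun B _ => range t \ B) ?_ ?_ ?_ ?_ ?_
    · intro A hA
      simp only [mem_filter, mem_powerset] at hA ⊢
      exact sdiff_subset_sdiff le_rfl hA.2
    · intro B hB
      simp only [mem_filter, mem_powerset] at hB ⊢
      refine ⟨sdiff_subset, fun x hx => mem_sdiff.2 ⟨hU hx, fun h => ?_⟩⟩
      exact (mem_sdiff.1 (hB h)).2 hx
    · intro A hA
      simp only [mem_filter, mem_powerset] at hA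
      exact Finset.sdiff_sdiff_eq_self hA.1
    · intro B hB
      simp only [mem_powerset] at hB
      exact Finset.sdiff_sdiff_eq_self (hB.trans sdiff_subset)
    · intro A hA
      simp only [mem_filter, mem_powerset] at hA
      rw [card_sdiff_of_subset hA.1, card_range]
  rw [h1, sum_powerset_neg_one_pow_card]
  refine if_congr ?_ rfl rfl
  rw [sdiff_eq_empty_iff_subset]
  exact ⟨fun h => hU.antisymm h, fun h => h.ge⟩

/-- The tuples of sets, given by indicator numbers, whose union is `{0, …, t - 1}`. -/
def coverTuples (k t : ℕ) : Finset (Fin k → ℕ) :=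
  {x ∈ Fintype.piFinset fun _ => range (2 ^ t) | (univ.biUnion fun c => bits t (x c)) = range t}

/-- Expanding the product of subset sums gives a sum over tuples whose union lies in `S`. After
exchanging the sums, a tuple with union `U` has as coefficient the alternating sum over the
supersets of `U`, which is `0` unless `U` is everything. -/
theorem sum_coverTuples (k t : ℕ) (g : ℕ → ℕ → ℕ) :
    ∑ S ∈ range (2 ^ t), (-1 : ℤ) ^ (t - #(bits t S)) *
        ((∏ c ∈ range k, zeta (g c) t S : ℕ) : ℤ) =
      ((∑ x ∈ coverTuples k t, ∏ c : Fin k, g c (x c) : ℕ) : ℤ) := by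
  have h1 : ∀ S ∈ range (2 ^ t), ((∏ c ∈ range k, zeta (g c) t S : ℕ) : ℤ) =
      ∑ x ∈ Fintype.piFinset fun _ : Fin k => range (2 ^ t),
        if (univ.biUnion fun c => bits t (x c)) ⊆ bits t S then
          ((∏ c : Fin k, g c (x c) : ℕ) : ℤ) else 0 := by
    intro S hS
    rw [prod_range, ← sum_filter, ← Nat.cast_sum]
    congr 1
    rw [prod_congr rfl fun (c : Fin k) _ => zeta_eq_sum_subset (g c) (mem_range.1 hS),
      prod_univ_sum (fun _ => {T ∈ range (2 ^ t) | bits t T ⊆ bits t S}) fun (c : Fin k) T => g c T]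
    refine sum_congr ?_ fun _ _ => rfl
    ext x
    simp only [Fintype.mem_piFinset, mem_filter, biUnion_subset, mem_univ, forall_const]
    exact forall_and
  rw [sum_congr rfl fun S hS => by rw [h1 S hS, mul_sum], sum_comm, coverTuples, sum_filter,
    Nat.cast_sum]
  refine sum_congr rfl fun x _ => ?_
  have hU : (univ.biUnion fun c => bits t (x c)) ⊆ range t :=
    biUnion_subset.2 fun c _ => bits_subset _ _
  rw [sum_bits t fun A => (-1 : ℤ) ^ (t - #A) *
    if (univ.biUnion fun c => bits t (x c)) ⊆ A then ((∏ c : Fin k, g c (x c) : ℕ) : ℤ) else 0]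
  have h2 := congrArg (· * ((∏ c : Fin k, g c (x c) : ℕ) : ℤ)) (sum_neg_one_pow_superset hU)
  simp only [sum_mul] at h2
  rw [sum_congr rfl fun A _ => show _ = (if (univ.biUnion fun c => bits t (x c)) ⊆ A then
    (-1 : ℤ) ^ (t - #A) else 0) * ((∏ c : Fin k, g c (x c) : ℕ) : ℤ) by split_ifs <;> simp, h2]
  split_ifs <;> simp

theorem card_coverTuples_le (k t : ℕ) : #(coverTuples k t) ≤ 2 ^ (t * k) := by
  refine (card_filter_le _ _).trans ?_
  simp [← pow_mul]

/-- The machine has no negative numbers, so positive and negative terms are summed separately. As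
the signed sum is a natural number, the truncated difference is exact. -/
theorem sub_parity_sums (t : ℕ) (p : ℕ → ℕ) (q : ℕ → ℕ) (s : Finset ℕ) (N : ℕ)
    (h : ∑ S ∈ s, (-1 : ℤ) ^ (t - p S) * (q S : ℤ) = N) :
    ∑ S ∈ s, (1 - (t - p S) % 2) * q S - ∑ S ∈ s, (t - p S) % 2 * q S = N := by
  have h1 : ∑ S ∈ s, (-1 : ℤ) ^ (t - p S) * (q S : ℤ) =
      ((∑ S ∈ s, (1 - (t - p S) % 2) * q S : ℕ) : ℤ) - ((∑ S ∈ s, (t - p S) % 2 * q S : ℕ) : ℤ) := by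
    rw [Nat.cast_sum, Nat.cast_sum, ← sum_sub_distrib]
    refine sum_congr rfl fun S _ => ?_
    rcases Nat.even_or_odd (t - p S) with h | h
    · simp [h.neg_one_pow, Nat.even_iff.1 h]
    · simp [h.neg_one_pow, Nat.odd_iff.1 h]
  omega

/-- The maximum of `f` over the `x` with `p x = t` can be read off from a sum of powers. -/
theorem radix_pow_le_iff {ι : Type*} {X : Finset ι} {p f : ι → ℕ} {W D t L : ℕ}
    (hp : ∀ x ∈ X, t ≤ p x) (hf : ∀ x ∈ X, f x < D) (hX : #X < W) :
    W ^ L ≤ (∑ x ∈ X, W ^ (D * p x + f x)) / W ^ (D * t) % W ^ D ↔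
      ∃ x ∈ X, p x = t ∧ L ≤ f x := by
  have hW : 0 < W := by omega
  -- Fewer than `W` terms, each at most `W ^ (m - 1)`.
  have small : ∀ (Y : Finset ι) (m : ℕ), Y ⊆ X → (∀ x ∈ Y, f x < m) →
      ∑ x ∈ Y, W ^ f x < W ^ m := by
    intro Y m hY hm
    rcases Y.eq_empty_or_nonempty with rfl | ⟨x, hx⟩
    · simp [hW]
    obtain ⟨m, rfl⟩ : ∃ m', m = m' + 1 := ⟨m - 1, by have := hm x hx; omega⟩
    calc ∑ x ∈ Y, W ^ f x ≤ ∑ x ∈ Y, W ^ m :=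
          sum_le_sum fun x hx => Nat.pow_le_pow_right hW (Nat.lt_succ_iff.1 (hm x hx))
      _ = #Y * W ^ m := by simp
      _ < W * W ^ m := Nat.mul_lt_mul_of_pos_right ((card_le_card hY).trans_lt hX) (by positivity)
      _ = W ^ (m + 1) := by rw [pow_succ, mul_comm]
  have hA := small {x ∈ X | p x = t} D (filter_subset _ _) fun x hx => hf x (mem_filter.1 hx).1
  -- Terms with `p x > t` are divisible by `W ^ (D * (t + 1))`, so they disappear modulo `W ^ D`
  -- after the division.
  have key : (∑ x ∈ X, W ^ (D * p x + f x)) = W ^ (D * t) * (∑ x ∈ X with p x = t, W ^ f x +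
      W ^ D * ∑ x ∈ X with ¬ p x = t, W ^ (D * (p x - t - 1) + f x)) := by
    rw [← sum_filter_add_sum_filter_not X fun x => p x = t, mul_add, mul_sum, mul_sum, mul_sum]
    congr 1
    · refine sum_congr rfl fun x hx => ?_
      rw [(mem_filter.1 hx).2, pow_add]
    · refine sum_congr rfl fun x hx => ?_
      rw [← pow_add, ← pow_add]
      congr 1
      have h1 := hp x (mem_filter.1 hx).1
      have h2 := (mem_filter.1 hx).2
      obtain ⟨e, he⟩ : ∃ e, p x = t + 1 + e := ⟨p x - t - 1, by omega⟩
      rw [he, show t + 1 + e - t - 1 = e by omega]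
      ring
  rw [key, Nat.mul_div_cancel_left _ (by positivity), Nat.add_mul_mod_self_left,
    Nat.mod_eq_of_lt hA]
  constructor
  · intro h
    by_contra! hc
    refine (small {x ∈ X | p x = t} L (filter_subset _ _) fun x hx => ?_).not_ge h
    exact hc x (mem_filter.1 hx).1 (mem_filter.1 hx).2
  · rintro ⟨x, hx, h1, h2⟩
    exact (Nat.pow_le_pow_right hW h2).trans
      (single_le_sum (f := fun x => W ^ f x) (fun _ _ => Nat.zero_le _) (mem_filter.2 ⟨hx, h1⟩))

end HappyEdges

/-! ### Types of vertices -/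

namespace SimpleGraph

variable {V : Type*} {G : SimpleGraph V} {u v w : V}

theorem sameType_iff : G.SameType u v ↔ ∀ w, w ≠ u → w ≠ v → (G.Adj u w ↔ G.Adj v w) := by
  rw [SameType, Set.ext_iff]
  refine forall_congr' fun w => ?_
  simp only [Set.mem_sdiff, mem_neighborSet, Set.mem_singleton_iff]
  by_cases hu : w = u <;> by_cases hv : w = v <;> simp_all

theorem SameType.refl (u : V) : G.SameType u u := rfl

theorem SameType.symm (h : G.SameType u v) : G.SameType v u := Eq.symm h

theorem SameType.trans (h : G.SameType u v) (h' : G.SameType v w) : G.SameType u w := by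
  by_cases huw : u = w
  · exact huw ▸ SameType.refl u
  rw [sameType_iff] at *
  intro x hu hw
  by_cases hx : x = v
  · subst hx
    -- At the middle vertex `v`: `u` is adjacent to `v` iff it is adjacent to `w`, because `v` and
    -- `w` have the same type, and this holds iff `v` is adjacent to `w`, because `u` and `v` have
    -- the same type.
    rw [G.adj_comm u, G.adj_comm w, h' u hu.symm huw, G.adj_comm w u, h w (Ne.symm huw) hw.symm]
  · exact (h x hu hx).trans (h' x hx hw)

/-- Vertices of pairwise different types lie in different parts of every type partition. -/
theorem card_le_neighborhoodDiversity [Fintype V] [DecidableEq V] {s : Finset V}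
    (hs : ∀ u ∈ s, ∀ v ∈ s, G.SameType u v → u = v) : s.card ≤ G.neighborhoodDiversity := by
  refine le_csInf ?_ ?_
  · refine ⟨_, ⊥, fun A hA u hu v hv => ?_, rfl⟩
    obtain ⟨w, -, rfl⟩ := Finset.mem_map.1 hA
    rw [Finset.mem_singleton.1 hu, Finset.mem_singleton.1 hv]
    exact .refl w
  · rintro _ ⟨P, hP, rfl⟩
    refine Finset.card_le_card_of_injOn (fun v => P.part v) (fun v _ => ?_) fun u hu v hv h => ?_
    · exact P.part_mem.2 (Finset.mem_univ v)
    · refine hs u hu v hv (hP _ (P.part_mem.2 (Finset.mem_univ v)) u ?_ v ?_)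
      · rw [← show P.part u = P.part v from h]
        exact P.mem_part (Finset.mem_univ u)
      · exact P.mem_part (Finset.mem_univ v)

open Finset Classical in
/-- Twice the number of happy edges. -/
theorem sum_happy_eq [Fintype V] {C : Type*} (c : V → C) :
    ∑ u, ∑ v, (if G.Adj u v ∧ c u = c v then 1 else 0) = 2 * (G.happyEdges c).ncard := by
  -- The happy edges form a graph, to which the handshake lemma applies.
  let H : SimpleGraph V :=
    { Adj := fun u v => G.Adj u v ∧ c u = c v
      symm := ⟨fun u v h => ⟨h.1.symm, h.2.symm⟩⟩
      loopless := ⟨fun u h => G.irrefl h.1⟩ }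
  have h1 : G.happyEdges c = (H.edgeFinset : Set (Sym2 V)) := by
    ext e
    induction e with | _ u v
    simp only [happyEdges, Set.mem_ofPred_eq, mem_edgeSet, Sym2.mem_iff, coe_edgeFinset, H]
    refine and_congr_right fun _ => ⟨fun h => h u (.inl rfl) v (.inr rfl), ?_⟩
    rintro h x (rfl | rfl) y (rfl | rfl) <;> simp [h]
  rw [h1, Set.ncard_coe_finset, ← H.sum_degrees_eq_twice_card_edges]
  refine sum_congr rfl fun u _ => ?_
  rw [sum_boole, ← card_neighborFinset_eq_degree]
  norm_cast
  congr 1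
  ext v
  simp [H]

open Finset Classical in
/-- Giving one and the same suitable color to a set of vertices of the same type does not decrease
the number of happy edges. -/
theorem exists_recolor [Fintype V] {C : Type*} [Finite C] [Nonempty C] (c : V → C) (U : Finset V)
    (hU : ∀ u ∈ U, ∀ v ∈ U, G.SameType u v) :
    ∃ i, ∑ u, ∑ v, (if G.Adj u v ∧ c u = c v then 1 else 0) ≤
      ∑ u, ∑ v, (if G.Adj u v ∧ (if u ∈ U then i else c u) = (if v ∈ U then i else c v)
        then 1 else 0) := by
  have split : ∀ d : V → C, ∑ u, ∑ v, (if G.Adj u v ∧ d u = d v then 1 else 0) =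
      ∑ u ∈ U, ∑ v ∈ U, (if G.Adj u v ∧ d u = d v then 1 else 0) +
      2 * ∑ u ∈ U, ∑ v ∈ Uᶜ, (if G.Adj u v ∧ d u = d v then 1 else 0) +
      ∑ u ∈ Uᶜ, ∑ v ∈ Uᶜ, (if G.Adj u v ∧ d u = d v then 1 else 0) := by
    intro d
    have h1 : ∑ u ∈ Uᶜ, ∑ v ∈ U, (if G.Adj u v ∧ d u = d v then 1 else 0) =
        ∑ u ∈ U, ∑ v ∈ Uᶜ, (if G.Adj u v ∧ d u = d v then 1 else 0) := by
      rw [sum_comm]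
      simp only [G.adj_comm, eq_comm]
    rw [← sum_add_sum_compl U]
    simp only [← sum_add_sum_compl U fun v => if G.Adj _ v ∧ d _ = d v then 1 else 0,
      sum_add_distrib]
    rw [h1]
    ring
  rcases U.eq_empty_or_nonempty with rfl | ⟨u₀, hu₀⟩
  · exact ⟨Classical.arbitrary C, by simp⟩
  -- The color that makes most edges from `u₀` to the complement of `U` happy. All vertices of `U`
  -- have the same neighbors there, so it is optimal for each of them.
  obtain ⟨i, hi⟩ := Finite.exists_max fun i =>
    ∑ v ∈ Uᶜ, (if G.Adj u₀ v ∧ i = c v then 1 else 0)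
  refine ⟨i, ?_⟩
  rw [split c, split fun u => if u ∈ U then i else c u]
  have h1 : ∑ u ∈ U, ∑ v ∈ U, (if G.Adj u v ∧ c u = c v then 1 else 0) ≤
      ∑ u ∈ U, ∑ v ∈ U, (if G.Adj u v ∧ (if u ∈ U then i else c u) = (if v ∈ U then i else c v)
        then 1 else 0) := by
    -- After recoloring, every edge inside `U` is happy.
    refine sum_le_sum fun u hu => sum_le_sum fun v hv => ?_
    simp only [hu, hv, if_true, and_true]
    split_ifs <;> simp_all
  have h2 : ∑ u ∈ U, ∑ v ∈ Uᶜ, (if G.Adj u v ∧ c u = c v then 1 else 0) ≤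
      ∑ u ∈ U, ∑ v ∈ Uᶜ, (if G.Adj u v ∧ (if u ∈ U then i else c u) = (if v ∈ U then i else c v)
        then 1 else 0) := by
    refine sum_le_sum fun u hu => ?_
    have hadj : ∀ v ∈ Uᶜ, (G.Adj u v ↔ G.Adj u₀ v) := fun v hv => by
      rw [mem_compl] at hv
      refine sameType_iff.1 (hU u hu u₀ hu₀) v ?_ ?_ <;> rintro rfl <;> contradiction
    refine (le_of_eq ?_).trans ((hi (c u)).trans (le_of_eq ?_))
    · refine sum_congr rfl fun v hv => ?_
      rw [hadj v hv]
    · refine sum_congr rfl fun v hv => ?_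
      rw [hadj v hv, if_pos hu, if_neg (mem_compl.1 hv)]
  have h3 : ∑ u ∈ Uᶜ, ∑ v ∈ Uᶜ, (if G.Adj u v ∧ c u = c v then 1 else 0) =
      ∑ u ∈ Uᶜ, ∑ v ∈ Uᶜ, (if G.Adj u v ∧
        (if u ∈ U then i else c u) = (if v ∈ U then i else c v) then 1 else 0) := by
    refine sum_congr rfl fun u hu => sum_congr rfl fun v hv => ?_
    rw [if_neg (mem_compl.1 hu), if_neg (mem_compl.1 hv)]
  omega

open Finset Classical in
/-- In an optimal extension of a partial coloring, uncolored vertices of the same type may be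
assumed to get the same color. -/
theorem exists_extension_constant_on_types [Fintype V] {C : Type*} [Finite C] [Nonempty C]
    (p : V → Option C) (id : V → ℕ) (hid : ∀ u v, id u = id v → G.SameType u v) (c : V → C)
    (hc : ∀ v i, p v = some i → c v = i) :
    ∃ c' : V → C, (∀ v i, p v = some i → c' v = i) ∧
      (∀ u v, p u = none → p v = none → id u = id v → c' u = c' v) ∧
      (G.happyEdges c).ncard ≤ (G.happyEdges c').ncard := by
  -- The types are recolored one after the other; those with number below `m` are done. Recoloring
  -- type `m` does not touch them.
  have key : ∀ m, ∃ c' : V → C, (∀ v i, p v = some i → c' v = i) ∧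
      (∀ u v, p u = none → p v = none → id u = id v → id u < m → c' u = c' v) ∧
      (G.happyEdges c).ncard ≤ (G.happyEdges c').ncard := by
    intro m
    induction m with
    | zero => exact ⟨c, hc, fun _ _ _ _ _ h => absurd h (Nat.not_lt_zero _), le_rfl⟩
    | succ m ih =>
      obtain ⟨d, h1, h2, h3⟩ := ih
      obtain ⟨i, hi⟩ := exists_recolor (G := G) d {u | p u = none ∧ id u = m} fun u hu v hv =>
        hid u v ((mem_filter.1 hu).2.2.trans (mem_filter.1 hv).2.2.symm)
      refine ⟨fun u => if u ∈ ({u | p u = none ∧ id u = m} : Finset V) then i else d u,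
        fun v i hv => ?_, fun u v hu hv he hm => ?_, h3.trans ?_⟩
      · simp [hv, h1 v i hv]
      · by_cases hum : id u = m
        · have hvm : id v = m := he ▸ hum
          simp [hu, hv, hum, hvm]
        · have hvm : id v ≠ m := he ▸ hum
          simp [hum, hvm, h2 u v hu hv he (by omega)]
      · rw [sum_happy_eq d, sum_happy_eq fun u =>
          if u ∈ ({u | p u = none ∧ id u = m} : Finset V) then i else d u] at hi
        omega
  obtain ⟨c', h1, h2, h3⟩ := key (univ.sup id + 1)
  exact ⟨c', h1, fun u v hu hv he => h2 u v hu hv he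
    (Nat.lt_succ_of_le (le_sup (f := id) (mem_univ u))), h3⟩

end SimpleGraph

namespace HappyEdges

open Finset

/-! ### Numbering the types -/

theorem sameType_le_one (M : ℕ → ℕ) (u v : ℕ) : sameType M u v ≤ 1 :=
  Nat.sub_le _ _

theorem prod_one_sub_sameType (M : ℕ → ℕ) (v w : ℕ) :
    ∏ u ∈ range w, (1 - sameType M u v) = if ∀ u < w, sameType M u v = 0 then 1 else 0 := by
  split_ifs with h
  · exact prod_eq_one fun u hu => by simp [h u (mem_range.1 hu)]
  · push Not at h
    obtain ⟨u, hu, h⟩ := h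
    refine prod_eq_zero (mem_range.2 hu) ?_
    omega

theorem isRep_eq (M : ℕ → ℕ) (v : ℕ) :
    isRep M v = if ∀ u < v, sameType M u v = 0 then 1 else 0 :=
  prod_one_sub_sameType M v v

/-- The representatives of the types. -/
def reps (M : ℕ → ℕ) : Finset ℕ := {v ∈ range (M 0) | ∀ u < v, sameType M u v = 0}

theorem typeCount_eq (M : ℕ → ℕ) : typeCount M = #(reps M) := by
  simp [typeCount, isRep_eq, reps]

theorem typeId_eq (M : ℕ → ℕ) (v : ℕ) :
    typeId M v = #{w ∈ reps M | ∀ u ≤ w, sameType M u v = 0} := by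
  simp [typeId, isRep_eq, reps, prod_one_sub_sameType, filter_filter, ← ite_and, and_comm]

/-- The memory `M` contains the instance `I`. -/
structure Encodes {k : ℕ} (I : MHEInstance k) (M : ℕ → ℕ) : Prop where
  size : M 0 = I.n
  sign : M 1 = if I.ℓ < 0 then 1 else 0
  natAbs : M 2 = I.ℓ.natAbs
  color : ∀ v : Fin I.n, M (3 + v) = (I.precolor v).elim 0 fun i => (i : ℕ) + 1
  matrix : ∀ u v : Fin I.n, I.graph.Adj u v → M (3 + I.n + (I.n * u + v)) = 1
  matrix' : ∀ u v : Fin I.n, ¬ I.graph.Adj u v → M (3 + I.n + (I.n * u + v)) = 0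

section

variable {k : ℕ} {I : MHEInstance k} {M : ℕ → ℕ}

open Classical in
theorem Encodes.adj_eq (h : Encodes I M) (u v : Fin I.n) :
    adj M u v = if I.graph.Adj u v then 1 else 0 := by
  rw [adj, h.size]
  split_ifs with huv
  · rw [h.matrix u v huv]
  · rw [h.matrix' u v huv]

theorem Encodes.sameType_eq_one_iff (h : Encodes I M) (u v : Fin I.n) :
    sameType M u v = 1 ↔ I.graph.SameType u v := by
  classical
  rw [sameType, h.size, sum_range, SimpleGraph.sameType_iff]
  have : ∀ x, 1 - x = 1 ↔ x = 0 := fun x => by omega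
  rw [this, sum_eq_zero_iff]
  simp only [mem_univ, forall_const]
  refine forall_congr' fun w => ?_
  rw [h.adj_eq, h.adj_eq, isEq_eq, isEq_eq, isEq_eq]
  simp only [← Fin.ext_iff]
  by_cases hu : w = u <;> by_cases hv : w = v <;> by_cases h1 : I.graph.Adj u w <;>
    by_cases h2 : I.graph.Adj v w <;> simp [hu, hv, h1, h2]

theorem Encodes.sameType_refl (h : Encodes I M) {v : ℕ} (hv : v < M 0) : sameType M v v = 1 :=
  (h.sameType_eq_one_iff ⟨v, h.size ▸ hv⟩ ⟨v, h.size ▸ hv⟩).2 (.refl _)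

theorem Encodes.sameType_symm (h : Encodes I M) {u v : ℕ} (hu : u < M 0) (hv : v < M 0)
    (huv : sameType M u v = 1) : sameType M v u = 1 :=
  (h.sameType_eq_one_iff ⟨v, h.size ▸ hv⟩ ⟨u, h.size ▸ hu⟩).2
    ((h.sameType_eq_one_iff ⟨u, h.size ▸ hu⟩ ⟨v, h.size ▸ hv⟩).1 huv).symm

theorem Encodes.sameType_trans (h : Encodes I M) {u v w : ℕ} (hu : u < M 0) (hv : v < M 0)
    (hw : w < M 0) (huv : sameType M u v = 1) (hvw : sameType M v w = 1) : sameType M u w = 1 :=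
  (h.sameType_eq_one_iff ⟨u, h.size ▸ hu⟩ ⟨w, h.size ▸ hw⟩).2
    (((h.sameType_eq_one_iff ⟨u, h.size ▸ hu⟩ ⟨v, h.size ▸ hv⟩).1 huv).trans
      ((h.sameType_eq_one_iff ⟨v, h.size ▸ hv⟩ ⟨w, h.size ▸ hw⟩).1 hvw))

/-- The least vertex of the type of `v` represents it: by transitivity, an earlier vertex of the
representative's type would also have the type of `v`. -/
theorem Encodes.exists_rep (h : Encodes I M) {v : ℕ} (hv : v < M 0) :
    ∃ r ∈ reps M, sameType M r v = 1 ∧ ∀ u < r, sameType M u v = 0 := by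
  classical
  have hex : ∃ u, sameType M u v = 1 := ⟨v, h.sameType_refl hv⟩
  have hle : Nat.find hex ≤ v := Nat.find_min' hex (h.sameType_refl hv)
  have hmin : ∀ u < Nat.find hex, sameType M u v = 0 := fun u hu => by
    have := Nat.find_min hex hu
    have := sameType_le_one M u v
    omega
  refine ⟨Nat.find hex, mem_filter.2 ⟨mem_range.2 (hle.trans_lt hv), fun u hu => ?_⟩,
    Nat.find_spec hex, hmin⟩
  by_contra hne
  have h1 : sameType M u (Nat.find hex) = 1 := by
    have := sameType_le_one M u (Nat.find hex)
    omega
  have := h.sameType_trans ((hu.trans_le hle).trans hv) (hle.trans_lt hv) hv h1 (Nat.find_spec hex)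
  rw [hmin u hu] at this
  exact zero_ne_one this

/-- The type number is the rank of the representative `r` among all representatives. Hence different
types get different numbers, all below `typeCount`. -/
theorem typeId_eq_of_rep {v r : ℕ} (h1 : sameType M r v = 1)
    (h2 : ∀ u < r, sameType M u v = 0) : typeId M v = #{w ∈ reps M | w < r} := by
  rw [typeId_eq]
  congr 1
  refine filter_congr fun w _ => ⟨fun hw => ?_, fun hw u hu => h2 u (hu.trans_lt hw)⟩
  by_contra hr
  have := hw r (not_lt.1 hr)
  omega

theorem card_filter_lt_strictMono {s : Finset ℕ} {r r' : ℕ} (hr : r ∈ s) (h : r < r') :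
    #{w ∈ s | w < r} < #{w ∈ s | w < r'} := by
  refine card_lt_card (ssubset_iff_of_subset ?_ |>.2 ⟨r, by simp [hr, h], by simp⟩)
  exact fun w hw => by
    simp only [mem_filter] at hw ⊢
    exact ⟨hw.1, hw.2.trans h⟩

theorem Encodes.typeId_lt (h : Encodes I M) {v : ℕ} (hv : v < M 0) :
    typeId M v < typeCount M := by
  obtain ⟨r, hr, h1, h2⟩ := h.exists_rep hv
  rw [typeId_eq_of_rep h1 h2, typeCount_eq]
  exact card_lt_card (ssubset_iff_of_subset (filter_subset _ _) |>.2 ⟨r, hr, by simp⟩)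

theorem Encodes.sameType_of_typeId_eq (h : Encodes I M) {u v : Fin I.n}
    (huv : typeId M u = typeId M v) : I.graph.SameType u v := by
  have hu : (u : ℕ) < M 0 := u.isLt.trans_eq h.size.symm
  have hv : (v : ℕ) < M 0 := v.isLt.trans_eq h.size.symm
  obtain ⟨r, hr, h1, h2⟩ := h.exists_rep hu
  obtain ⟨r', hr', h1', h2'⟩ := h.exists_rep hv
  rw [typeId_eq_of_rep h1 h2, typeId_eq_of_rep h1' h2'] at huv
  have hrr : r = r' := by
    rcases lt_trichotomy r r' with hlt | heq | hlt
    · exact absurd huv (card_filter_lt_strictMono hr hlt).ne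
    · exact heq
    · exact absurd huv (card_filter_lt_strictMono hr' hlt).ne'
  subst hrr
  have hr0 : r < M 0 := mem_range.1 (mem_filter.1 hr).1
  exact (h.sameType_eq_one_iff u v).1
    (h.sameType_trans hu hr0 hv (h.sameType_symm hr0 hu h1) h1')

theorem Encodes.typeCount_le_neighborhoodDiversity (h : Encodes I M) :
    typeCount M ≤ I.graph.neighborhoodDiversity := by
  classical
  let s : Finset (Fin I.n) := {v | (v : ℕ) ∈ reps M}
  have hs : #(reps M) ≤ #s := by
    have : reps M = s.map Fin.valEmbedding := by
      ext v
      simp only [s, mem_map, mem_filter, mem_univ, true_and, Fin.valEmbedding_apply]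
      refine ⟨fun hv => ⟨⟨v, h.size ▸ mem_range.1 (mem_filter.1 hv).1⟩, hv, rfl⟩, ?_⟩
      rintro ⟨w, hw, rfl⟩
      exact hw
    rw [this, card_map]
  rw [typeCount_eq]
  refine hs.trans (SimpleGraph.card_le_neighborhoodDiversity fun u hu v hv huv => ?_)
  have hu' := (mem_filter.1 (mem_filter.1 hu).2).2
  have hv' := (mem_filter.1 (mem_filter.1 hv).2).2
  rcases lt_trichotomy u v with hlt | heq | hlt
  · have := hv' u hlt
    rw [(h.sameType_eq_one_iff u v).2 huv] at this
    exact absurd this one_ne_zero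
  · exact heq
  · have := hu' v hlt
    rw [(h.sameType_eq_one_iff v u).2 huv.symm] at this
    exact absurd this one_ne_zero

/-! ### Colorings and tuples of sets of types -/

/-- The tuple `x` of sets of types is a partition, and describes the coloring `c`. -/
def Describes (I : MHEInstance k) (M : ℕ → ℕ) (x : Fin k → ℕ) (c : Fin I.n → Fin k) : Prop :=
  ∀ v, I.precolor v = none → ∀ i, (x i).testBit (typeId M v) ↔ c v = i

theorem Encodes.inClass_eq (h : Encodes I M) {x : Fin k → ℕ} {c : Fin I.n → Fin k}
    (hc : I.IsExtension c) (hx : Describes I M x c) (i : Fin k) (v : Fin I.n) :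
    inClass M i (x i) v = if c v = i then 1 else 0 := by
  rw [inClass, h.color, isEq_eq, isEq_eq, bit_eq]
  rcases hv : I.precolor v with _ | j
  · simp [hx v hv i]
  · simp [hc v j hv, Fin.ext_iff]

theorem Encodes.sum_happy_eq (h : Encodes I M) {x : Fin k → ℕ} {c : Fin I.n → Fin k}
    (hc : I.IsExtension c) (hx : Describes I M x c) :
    ∑ i : Fin k, happy M i (x i) = 2 * (I.graph.happyEdges c).ncard := by
  classical
  rw [← SimpleGraph.sum_happy_eq]
  simp only [happy, h.size, sum_range, h.inClass_eq hc hx, h.adj_eq]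
  rw [sum_comm]
  refine sum_congr rfl fun u _ => ?_
  rw [sum_comm]
  refine sum_congr rfl fun v _ => ?_
  -- An ordered pair `u`, `v` can be counted only for the color of `u`.
  rw [sum_eq_single (c u)]
  · by_cases h1 : I.graph.Adj u v <;> by_cases h2 : c u = c v <;> simp [h1, h2, eq_comm]
  · intro i _ hi
    simp [hi.symm]
  · simp

/-- A covering tuple whose sets have `t` elements altogether is a partition. -/
theorem existsUnique_testBit {t : ℕ} {x : Fin k → ℕ} (hx : x ∈ coverTuples k t)
    (hp : ∑ i, #(bits t (x i)) = t) {j : ℕ} (hj : j < t) : ∃! i, (x i).testBit j := by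
  have hcov : ∀ j ∈ range t, 1 ≤ ∑ i, bit (x i) j := by
    intro j hj
    rw [← (mem_filter.1 hx).2] at hj
    obtain ⟨i, -, hi⟩ := mem_biUnion.1 hj
    have h1 : bit (x i) j = 1 := by rw [bit_eq, if_pos (mem_bits.1 hi).2]
    exact h1.ge.trans (single_le_sum (f := fun i => bit (x i) j)
      (fun _ _ => Nat.zero_le _) (mem_univ i))
  -- Each of the `t` elements is covered at least once and the multiplicities sum to `t`, so each is
  -- covered exactly once.
  have hsum : ∑ j ∈ range t, 1 = ∑ j ∈ range t, ∑ i, bit (x i) j := by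
    rw [sum_comm]
    simp [sum_bit, hp]
  have h1 := (sum_eq_sum_iff_of_le hcov).1 hsum j (mem_range.2 hj)
  have h2 : ∑ i, bit (x i) j = #{i | (x i).testBit j} := by simp [bit_eq]
  rw [h2] at h1
  obtain ⟨i, hi⟩ := card_eq_one.1 h1.symm
  have h3 : ∀ i', (x i').testBit j ↔ i' = i := fun i' => by
    have : i' ∈ ({i | (x i).testBit j} : Finset (Fin k)) ↔ i' ∈ ({i} : Finset (Fin k)) := by
      rw [hi]
    simpa using this
  exact ⟨i, (h3 i).2 rfl, fun i' h => (h3 i').1 h⟩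

/-- An uncolored vertex receives the unique color whose set contains its type; precolored vertices
keep their color. -/
theorem Encodes.exists_coloring (h : Encodes I M) {x : Fin k → ℕ}
    (hx : x ∈ coverTuples k (typeCount M))
    (hp : ∑ i, #(bits (typeCount M) (x i)) = typeCount M) :
    ∃ c, I.IsExtension c ∧ Describes I M x c := by
  have hu := fun v : Fin I.n => existsUnique_testBit hx hp (h.typeId_lt (v.isLt.trans_eq h.size.symm))
  choose f hf hf' using hu
  refine ⟨fun v => (I.precolor v).getD (f v), fun v i hv => by simp [hv], fun v hv i => ?_⟩
  simp only [hv, Option.getD_none]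
  exact ⟨fun hi => (hf' v i hi).symm, fun hi => hi ▸ hf v⟩

theorem Encodes.exists_tuple (h : Encodes I M) (hk : 1 ≤ k) {c : Fin I.n → Fin k}
    (hc : ∀ u v, I.precolor u = none → I.precolor v = none → typeId M u = typeId M v →
      c u = c v) :
    ∃ x ∈ coverTuples k (typeCount M), ∑ i, #(bits (typeCount M) (x i)) = typeCount M ∧
      Describes I M x c := by
  classical
  set t := typeCount M
  obtain ⟨f, hf⟩ : ∃ f : ℕ → Fin k, ∀ v, I.precolor v = none → f (typeId M v) = c v := by
    -- Types without uncolored vertices must also be put into some set; they go to color `0`, which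
    -- exists since `1 ≤ k`.
    refine ⟨fun j => if h : ∃ v, I.precolor v = none ∧ typeId M v = j then c h.choose
      else ⟨0, hk⟩, fun v hv => ?_⟩
    have h : ∃ w : Fin I.n, I.precolor w = none ∧ typeId M w = typeId M v := ⟨v, hv, rfl⟩
    simp only [dif_pos h]
    exact hc _ _ h.choose_spec.1 hv h.choose_spec.2
  have hex : ∀ i : Fin k, ∃ S < 2 ^ t, bits t S = {j ∈ range t | f j = i} :=
    fun i => exists_bits_eq (filter_subset _ _)
  choose x hx hb using hex
  refine ⟨x, mem_filter.2 ⟨?_, ?_⟩, ?_, fun v hv i => ?_⟩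
  · simpa [Fintype.mem_piFinset] using hx
  · ext j
    simp [hb]
  · simp only [hb]
    rw [← card_eq_sum_card_fiberwise (f := f) (t := univ) (by simp), card_range]
  · rw [← hf v hv]
    have hv : typeId M v < t := h.typeId_lt (v.isLt.trans_eq h.size.symm)
    have : typeId M v ∈ bits t (x i) ↔ typeId M v ∈ ({j ∈ range t | f j = i} : Finset ℕ) := by
      rw [hb]
    simpa [mem_bits, hv] using this

/-- What the algorithm decides. -/
theorem Encodes.exists_tuple_iff_isYes (h : Encodes I M) (hk : 1 ≤ k) :
    (∃ x ∈ coverTuples k (typeCount M), ∑ i, popcount M (x i) = typeCount M ∧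
      target k M ≤ ∑ i : Fin k, happy M i (x i)) ↔ I.IsYes := by
  have hpop : ∀ S, popcount M S = #(bits (typeCount M) S) := fun S => sum_bit _ S
  simp only [hpop]
  -- The target is the minimum of `2 * ℓ` and `valueBound` when `ℓ ≥ 0`, so below `valueBound` the
  -- cap does not affect the comparison. For negative `ℓ` both sides hold.
  have htarget : ∀ m, 2 * m < valueBound k M → (target k M ≤ 2 * m ↔ I.ℓ ≤ (m : ℤ)) := by
    intro m hm
    rw [target, h.sign, h.natAbs]
    split_ifs with hl
    · simp
      omega
    · rw [Nat.sub_zero, one_mul]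
      omega
  have hbound : ∀ x : Fin k → ℕ, ∑ i : Fin k, happy M i (x i) < valueBound k M := fun x =>
    Nat.lt_succ_of_le ((sum_le_card_nsmul univ _ _ fun (i : Fin k) _ => happy_le M i (x i)).trans (by simp))
  constructor
  · rintro ⟨x, hx, hp, ht⟩
    obtain ⟨c, hc, hd⟩ := h.exists_coloring hx hp
    have hb := hbound x
    rw [h.sum_happy_eq hc hd] at ht hb
    exact ⟨c, hc, (htarget _ hb).1 ht⟩
  · rintro ⟨c, hc, hl⟩
    have : Nonempty (Fin k) := ⟨⟨0, hk⟩⟩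
    obtain ⟨c', h1, h2, h3⟩ := SimpleGraph.exists_extension_constant_on_types (G := I.graph)
      I.precolor (fun v => typeId M v) (fun u v => h.sameType_of_typeId_eq) c hc
    obtain ⟨x, hx, hp, hd⟩ := h.exists_tuple hk h2
    have hb := hbound x
    refine ⟨x, hx, hp, ?_⟩
    rw [h.sum_happy_eq h1 hd] at hb ⊢
    exact (htarget _ hb).2 (hl.trans (by exact_mod_cast h3))

end

end HappyEdges

namespace HappyEdges

open Finset RAM

/-! ### Correctness of the final evaluation -/

theorem sum_happy_lt {k : ℕ} (M : ℕ → ℕ) (x : Fin k → ℕ) :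
    ∑ i : Fin k, happy M i (x i) < valueBound k M :=
  Nat.lt_succ_of_le ((sum_le_card_nsmul univ _ _ fun (i : Fin k) _ =>
    happy_le M i (x i)).trans (by simp))

theorem total_eq {k : ℕ} {M : ℕ → ℕ} (hT : ∀ c < k, ∀ S < 2 ^ typeCount M,
      M (tableBase M + index M c (typeCount M) S) = zeta (weight k M c) (typeCount M) S) :
    total k M = ∑ x ∈ coverTuples k (typeCount M), radix k M ^
      (valueBound k M * ∑ i, popcount M (x i) + ∑ i : Fin k, happy M i (x i)) := by
  refine sub_parity_sums _ (popcount M) (product k M) _ _ ?_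
  have h := sum_coverTuples k (typeCount M) (weight k M)
  refine Eq.trans (sum_congr rfl fun S hS => ?_) (h.trans ?_)
  · rw [product, prod_congr rfl fun c hc => hT c (mem_range.1 hc) S (mem_range.1 hS),
      popcount, sum_bit]
  · congr 1
    refine sum_congr rfl fun x _ => ?_
    simp only [weight]
    rw [prod_pow_eq_pow_sum, sum_add_distrib, mul_sum]

theorem Encodes.answer_eq {k : ℕ} {I : MHEInstance k} {M : ℕ → ℕ} (h : Encodes I M) (hk : 1 ≤ k)
    (hT : ∀ c < k, ∀ S < 2 ^ typeCount M,
      M (tableBase M + index M c (typeCount M) S) = zeta (weight k M c) (typeCount M) S) :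
    (I.IsYes → answer k M = 1) ∧ (¬ I.IsYes → answer k M = 0) := by
  have key := radix_pow_le_iff (X := coverTuples k (typeCount M))
    (p := fun x => ∑ i, popcount M (x i)) (f := fun x => ∑ i : Fin k, happy M i (x i))
    (W := radix k M) (D := valueBound k M) (t := typeCount M) (L := target k M)
    (fun x hx => ?_) (fun x _ => sum_happy_lt M x) ?_
  · rw [h.exists_tuple_iff_isYes hk, ← total_eq hT] at key
    rw [← key, answer]
    omega
  · simp only [popcount, sum_bit]
    calc typeCount M = #(univ.biUnion fun c => bits (typeCount M) (x c)) := by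
          rw [(mem_filter.1 hx).2, card_range]
      _ ≤ _ := card_biUnion_le
  · refine (card_coverTuples_le _ _).trans_lt (Nat.pow_lt_pow_right one_lt_two ?_)
    exact Nat.lt_succ_of_le (Nat.mul_le_mul_right _ (typeCount_le M))

/-! ### The table -/

section

variable {k : ℕ} {M M' : ℕ → ℕ}

/-- Filling the table changes no cell below `tableBase`. This and the following congruences show
that everything computed from the input part alone keeps its value meanwhile. -/
theorem adj_congr (h : ∀ x < tableBase M, M' x = M x) {u v : ℕ} (hu : u < M 0) (hv : v < M 0) :
    adj M' u v = adj M u v := by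
  have h1 : M 0 * u + v < M 0 * M 0 := by
    have := Nat.mul_le_mul_left (M 0) (Nat.succ_le_of_lt hu)
    rw [Nat.mul_succ] at this
    omega
  rw [adj, adj, h 0 (by unfold tableBase; omega), h _ (by unfold tableBase; omega)]

theorem size_congr (h : ∀ x < tableBase M, M' x = M x) : M' 0 = M 0 :=
  h 0 (by unfold tableBase; omega)

theorem sameType_congr (h : ∀ x < tableBase M, M' x = M x) {u v : ℕ} (hu : u < M 0)
    (hv : v < M 0) : sameType M' u v = sameType M u v := by
  rw [sameType, sameType, size_congr h]
  congr 1
  refine sum_congr rfl fun w hw => ?_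
  rw [adj_congr h hu (mem_range.1 hw), adj_congr h hv (mem_range.1 hw)]

theorem isRep_congr (h : ∀ x < tableBase M, M' x = M x) {v : ℕ} (hv : v < M 0) :
    isRep M' v = isRep M v :=
  prod_congr rfl fun u hu => by rw [sameType_congr h ((mem_range.1 hu).trans hv) hv]

theorem typeCount_congr (h : ∀ x < tableBase M, M' x = M x) : typeCount M' = typeCount M := by
  rw [typeCount, typeCount, size_congr h]
  exact sum_congr rfl fun v hv => isRep_congr h (mem_range.1 hv)

theorem typeId_congr (h : ∀ x < tableBase M, M' x = M x) {v : ℕ} (hv : v < M 0) :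
    typeId M' v = typeId M v := by
  rw [typeId, typeId, size_congr h]
  refine sum_congr rfl fun w hw => ?_
  rw [mem_range] at hw
  rw [isRep_congr h hw]
  congr 1
  refine prod_congr rfl fun u hu => ?_
  rw [mem_range] at hu
  rw [sameType_congr h (by omega) hv]

theorem inClass_congr (h : ∀ x < tableBase M, M' x = M x) (c S : ℕ) {v : ℕ} (hv : v < M 0) :
    inClass M' c S v = inClass M c S v := by
  rw [inClass, inClass, typeId_congr h hv, h (3 + v) (by unfold tableBase; omega)]

theorem happy_congr (h : ∀ x < tableBase M, M' x = M x) (c S : ℕ) :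
    happy M' c S = happy M c S := by
  rw [happy, happy, size_congr h]
  refine sum_congr rfl fun u hu => sum_congr rfl fun v hv => ?_
  rw [mem_range] at hu hv
  rw [adj_congr h hu hv, inClass_congr h c S hu, inClass_congr h c S hv]

theorem weight_congr (h : ∀ x < tableBase M, M' x = M x) (c S : ℕ) :
    weight k M' c S = weight k M c S := by
  rw [weight, weight, radix, radix, valueBound, valueBound, popcount, popcount, happy_congr h,
    typeCount_congr h, size_congr h]

theorem tableBase_congr (h : ∀ x < tableBase M, M' x = M x) : tableBase M' = tableBase M := by
  rw [tableBase, tableBase, size_congr h]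

theorem index_congr (h : ∀ x < tableBase M, M' x = M x) (c j S : ℕ) :
    index M' c j S = index M c j S := by
  rw [index, index, typeCount_congr h]

theorem Encodes.congr {I : MHEInstance k} (hI : Encodes I M)
    (h : ∀ x < tableBase M, M' x = M x) : Encodes I M' := by
  have hn := hI.size
  have hlt : ∀ u v : Fin I.n, 3 + I.n + (I.n * u + v) < tableBase M := fun u v => by
    have := Nat.mul_le_mul_left I.n (Nat.succ_le_of_lt u.isLt)
    rw [Nat.mul_succ] at this
    rw [tableBase, hn]
    omega
  refine ⟨(size_congr h).trans hn, (h 1 ?_).trans hI.sign, (h 2 ?_).trans hI.natAbs,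
    fun v => (h _ ?_).trans (hI.color v), fun u v huv => (h _ (hlt u v)).trans (hI.matrix u v huv),
    fun u v huv => (h _ (hlt u v)).trans (hI.matrix' u v huv)⟩
  · unfold tableBase; omega
  · unfold tableBase; omega
  · unfold tableBase; omega

/-- The final value of the table entry at position `i`. -/
def tableValue (k : ℕ) (M : ℕ → ℕ) (i : ℕ) : ℕ :=
  zeta (weight k M (i / 2 ^ typeCount M / (typeCount M + 1)))
    (i / 2 ^ typeCount M % (typeCount M + 1)) (i % 2 ^ typeCount M)

theorem index_div (M : ℕ → ℕ) (c j : ℕ) {S : ℕ} (hS : S < 2 ^ typeCount M) :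
    index M c j S / 2 ^ typeCount M = c * (typeCount M + 1) + j := by
  rw [index, mul_comm, Nat.mul_add_div (by positivity), Nat.div_eq_of_lt hS, add_zero]

theorem index_mod (M : ℕ → ℕ) (c j : ℕ) {S : ℕ} (hS : S < 2 ^ typeCount M) :
    index M c j S % 2 ^ typeCount M = S := by
  rw [index, mul_comm, Nat.mul_add_mod, Nat.mod_eq_of_lt hS]

theorem tableValue_index (k : ℕ) (M : ℕ → ℕ) (c : ℕ) {j S : ℕ} (hj : j ≤ typeCount M)
    (hS : S < 2 ^ typeCount M) :
    tableValue k M (index M c j S) = zeta (weight k M c) j S := by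
  rw [tableValue, index_div M c j hS, index_mod M c j hS, mul_comm c, Nat.mul_add_div (by omega),
    Nat.mul_add_mod, Nat.div_eq_of_lt (by omega), Nat.mod_eq_of_lt (by omega), add_zero]

theorem exists_index_eq (M : ℕ → ℕ) (i : ℕ) :
    ∃ c j S, j ≤ typeCount M ∧ S < 2 ^ typeCount M ∧ i = index M c j S := by
  refine ⟨i / 2 ^ typeCount M / (typeCount M + 1), i / 2 ^ typeCount M % (typeCount M + 1),
    i % 2 ^ typeCount M, Nat.lt_succ_iff.1 (Nat.mod_lt _ (Nat.succ_pos _)),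
    Nat.mod_lt _ (by positivity), ?_⟩
  rw [index, Nat.div_add_mod', Nat.div_add_mod']

theorem index_lt (M : ℕ → ℕ) {c S : ℕ} (hc : c < k) (hS : S < 2 ^ typeCount M) :
    index M c (typeCount M) S < tableSize k M := by
  have h1 : c * (typeCount M + 1) + typeCount M + 1 ≤ k * (typeCount M + 1) := by
    have := Nat.mul_le_mul_right (typeCount M + 1) (Nat.succ_le_of_lt hc)
    rw [Nat.succ_mul] at this
    omega
  have h2 := Nat.mul_le_mul_right (2 ^ typeCount M) h1
  rw [Nat.succ_mul] at h2
  unfold index tableSize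
  omega

/-- The factors `1 - j` and `1 - (1 - j)` distinguish stage `j = 0` from the later ones. At a later
stage, the two values of the previous stage that are needed stand `2 ^ t` and `2 ^ t + 2 ^ (j - 1)`
positions earlier, so they have already been written. -/
theorem entry_eq_tableValue (k : ℕ) (M : ℕ → ℕ) (i : ℕ) :
    entry k (tableMem M (tableBase M) (tableValue k M) i) i = tableValue k M i := by
  have h : ∀ x < tableBase M, tableMem M (tableBase M) (tableValue k M) i x = M x :=
    fun x hx => tableMem_of_lt hx
  rw [entry, typeCount_congr h, tableBase_congr h, weight_congr h]
  obtain ⟨c, j, S, hj, hS, hi⟩ := exists_index_eq M i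
  have e1 : i / 2 ^ typeCount M = c * (typeCount M + 1) + j := by rw [hi, index_div M c j hS]
  have e2 : i % 2 ^ typeCount M = S := by rw [hi, index_mod M c j hS]
  have e3 : (c * (typeCount M + 1) + j) % (typeCount M + 1) = j := by
    rw [mul_comm c, Nat.mul_add_mod, Nat.mod_eq_of_lt (by omega)]
  have e4 : (c * (typeCount M + 1) + j) / (typeCount M + 1) = c := by
    rw [mul_comm c, Nat.mul_add_div (by omega), Nat.div_eq_of_lt (by omega), add_zero]
  have e5 : tableValue k M i = zeta (weight k M c) j S := by rw [hi, tableValue_index k M c hj hS]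
  rw [e5, e1, e2, e3, e4]
  rcases j with _ | j
  · simp [zeta]
  · have e6 : i = index M c j S + 2 ^ typeCount M := by
      rw [hi, index, index]
      ring
    have e7 : tableBase M + i - 2 ^ typeCount M = tableBase M + index M c j S := by omega
    have hpos : 0 < 2 ^ typeCount M := by positivity
    rw [e7, tableMem_base_add (by omega), tableValue_index k M c (by omega) hS, zeta,
      Nat.add_sub_cancel]
    -- If `j` is not in `S`, the address read has no meaning, but its content is multiplied by `0`.
    have e8 : bit S j * tableMem M (tableBase M) (tableValue k M) i
        (tableBase M + index M c j S - 2 ^ j) = bit S j * zeta (weight k M c) j (S - 2 ^ j) := by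
      rw [bit_eq]
      split_ifs with hb
      · have h1 := two_pow_le_of_testBit hb
        have h2 : tableBase M + index M c j S - 2 ^ j =
            tableBase M + index M c j (S - 2 ^ j) := by
          unfold index
          rw [← Nat.add_assoc, ← Nat.add_assoc, Nat.add_sub_assoc h1]
        have h3 : index M c j (S - 2 ^ j) ≤ index M c j S :=
          Nat.add_le_add_left (Nat.sub_le _ _) _
        rw [h2, tableMem_base_add (h3.trans_lt (by omega)),
          tableValue_index k M c (by omega) ((Nat.sub_le _ _).trans_lt hS)]
      · simp
    rw [e8]
    simp

/-- A polynomial bound for the number of digits of the table entries. -/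
def entrySizeBound (k n : ℕ) : ℕ :=
  n + (n * k + 1) * ((k * (n * n) + 1) * n + n * n) + 1

theorem size_tableValue_le (k : ℕ) (M : ℕ → ℕ) (i : ℕ) :
    Nat.size (tableValue k M i) ≤ entrySizeBound k (M 0) := by
  rw [Nat.size_le]
  have hj : i / 2 ^ typeCount M % (typeCount M + 1) ≤ M 0 :=
    (Nat.lt_succ_iff.1 (Nat.mod_lt _ (Nat.succ_pos _))).trans (typeCount_le M)
  have hw : ∀ c S, weight k M c S ≤
      2 ^ ((M 0 * k + 1) * ((k * (M 0 * M 0) + 1) * M 0 + M 0 * M 0)) := by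
    intro c S
    rw [weight, radix, valueBound, ← pow_mul]
    refine Nat.pow_le_pow_right two_pos (Nat.mul_le_mul_left _ (add_le_add ?_ (happy_le M c S)))
    exact Nat.mul_le_mul_left _ ((popcount_le M S).trans (typeCount_le M))
  -- After `j ≤ n` stages an entry is at most `2 ^ n` times the largest weight.
  refine (zeta_le (hw _) _ _).trans_lt ?_
  rw [← pow_add]
  refine Nat.pow_lt_pow_right one_lt_two ?_
  unfold entrySizeBound
  omega

end

/-! ### The input -/

theorem getElem?_flatMap_of_length {α β : Type*} {l : List α} {f : α → List β} {n : ℕ}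
    (hf : ∀ a, (f a).length = n) (i : ℕ) {j : ℕ} (hj : j < n) :
    (l.flatMap f)[n * i + j]? = l[i]?.bind fun a => (f a)[j]? := by
  induction l generalizing i with
  | nil => simp
  | cons a l ih =>
    rw [List.flatMap_cons]
    rcases i with _ | i
    · rw [Nat.mul_zero, Nat.zero_add, List.getElem?_append_left (by rw [hf]; exact hj)]
      simp
    · rw [List.getElem?_append_right (by rw [hf, Nat.mul_succ]; omega), hf,
        show n * (i + 1) + j - n = n * i + j by rw [Nat.mul_succ]; omega, ih]
      simp

variable {k : ℕ}

/-- The memory at the start. -/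
noncomputable def inputMem (I : MHEInstance k) : ℕ → ℕ := (start I.encode).mem

theorem encodes_inputMem (I : MHEInstance k) : Encodes I (inputMem I) := by
  classical
  have hm : ∀ u v : Fin I.n, inputMem I (3 + I.n + (I.n * u + v)) =
      if I.graph.Adj u v then 1 else 0 := by
    intro u v
    rw [inputMem, start, MHEInstance.encode]
    simp only [List.getD_eq_getElem?_getD]
    rw [List.getElem?_append_right (by simp; omega)]
    rw [show 3 + I.n + (I.n * u + v) - _ = I.n * u + v by simp; omega,
      getElem?_flatMap_of_length (n := I.n) (by simp) u v.isLt]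
    simp
  refine ⟨rfl, rfl, rfl, fun v => ?_, fun u v h => ?_, fun u v h => ?_⟩
  · rw [inputMem, start, MHEInstance.encode]
    simp only [List.getD_eq_getElem?_getD]
    rw [List.getElem?_append_left (by simp; omega), List.getElem?_append_right (by simp)]
    simp
  · rw [hm, if_pos h]
  · rw [hm, if_neg h]

theorem size_inputMem_le (I : MHEInstance k) (x : ℕ) :
    Nat.size (inputMem I x) ≤ I.n + Nat.size I.ℓ.natAbs + (k + 1) := by
  classical
  have hid : ∀ m : ℕ, Nat.size m ≤ m := fun m => Nat.size_le.2 Nat.lt_two_pow_self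
  have key : ∀ y ∈ I.encode, Nat.size y ≤ I.n + Nat.size I.ℓ.natAbs + (k + 1) := by
    intro y hy
    simp only [MHEInstance.encode, List.mem_append, List.mem_cons, List.mem_map,
      List.mem_flatMap, List.not_mem_nil, or_false] at hy
    rcases hy with ((rfl | rfl | rfl) | ⟨v, -, rfl⟩) | ⟨u, -, v, -, rfl⟩
    · have := hid I.n
      omega
    · split_ifs <;> simp only [Nat.size_zero, Nat.size_one] <;> omega
    · omega
    · refine (hid _).trans ?_
      rcases I.precolor v with _ | i
      · simp
      · have := i.isLt
        simp only [Option.elim_some]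
        omega
    · split_ifs <;> simp only [Nat.size_zero, Nat.size_one] <;> omega
  rw [inputMem, start]
  simp only [List.getD_eq_getElem?_getD]
  rcases hx : I.encode[x]? with _ | y
  · simp
  · exact key y (List.mem_of_getElem? hx)

/-! ### The program -/

/-- The size of an instance. -/
def instSize (I : MHEInstance k) : ℕ := I.n + Nat.size I.ℓ.natAbs

/-- The memory after the first `i` table entries have been written. -/
noncomputable def memAt (I : MHEInstance k) (i : ℕ) : ℕ → ℕ :=
  tableMem (inputMem I) (tableBase (inputMem I)) (tableValue k (inputMem I)) i

theorem memAt_of_lt (I : MHEInstance k) (i : ℕ) :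
    ∀ x < tableBase (inputMem I), memAt I i x = inputMem I x :=
  fun _ hx => tableMem_of_lt hx

theorem polyBdd_n : PolyBdd (instSize (k := k)) fun I => inputMem I 0 :=
  PolyBdd.self.mono fun I => by
    rw [(encodes_inputMem I).size]
    exact Nat.le_add_right _ _

theorem exists_size_memAt_le : ∃ q : Polynomial ℕ, ∀ (I : MHEInstance k) (i x : ℕ),
    Nat.size (memAt I i x) ≤ q.eval (instSize I) := by
  have hb : PolyBdd (instSize (k := k)) fun I =>
      entrySizeBound k (inputMem I 0) + (instSize I + (k + 1)) := by
    have hn := polyBdd_n (k := k)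
    exact ((hn.add (((hn.mul (.const k)).add (.const 1)).mul
      (((((PolyBdd.const k).mul (hn.mul hn)).add (.const 1)).mul hn).add (hn.mul hn)))).add
        (.const 1)).add (PolyBdd.self.add (.const (k + 1)))
  obtain ⟨q, hq⟩ := hb
  refine ⟨q, fun I i x => le_trans ?_ (hq I)⟩
  rw [memAt, tableMem]
  split_ifs
  · exact (size_tableValue_le _ _ _).trans (Nat.le_add_right _ _)
  · exact (size_inputMem_le I x).trans (Nat.le_add_left _ _)

/-- The states in the family `φ` of instances after `i` table entries have been written. -/
noncomputable def tableCtx {β : Type} (φ : β → MHEInstance k) (i : β → ℕ) : Ctx β :=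
  Ctx.ofMem (fun b => instSize (φ b)) (fun b => memAt (φ b) (i b))
    (exists_size_memAt_le.imp fun _ hq b => hq (φ b) (i b))
    ((polyBdd_n.comp φ).mono fun b => (size_congr (memAt_of_lt (φ b) (i b))).le)

theorem exists_prog (k : ℕ) : ∃ (P : Prog) (q : Polynomial ℕ), ∀ (I : MHEInstance k) (s : State),
    s.mem = inputMem I → ∃ T s', Exec P s T s' ∧
      T ≤ (tableSize k (inputMem I) + 1 + (2 ^ typeCount (inputMem I) + 1)) *
        q.eval (instSize I) ∧
      s'.reg 0 = answer k (memAt I (tableSize k (inputMem I))) := by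
  have h0 : ∀ I : MHEInstance k, memAt I 0 = inputMem I := fun I => tableMem_zero _ _ _
  have hN : PolyTime (tableCtx (k := k) id fun _ => 0) fun I => tableSize k (inputMem I) :=
    (polyTime_tableSize k).congr fun I => by
      change _ = tableSize k (memAt I 0)
      rw [h0]
  have hvar := PolyTime.var (Γ := tableCtx (β := Σ I : MHEInstance k,
    Fin (tableSize k (inputMem I))) Sigma.fst fun p => p.2) (x := fun p => p.2)
    ((hN.1.comp Sigma.fst).mono fun p => Nat.size_le_size p.2.isLt.le) 1 (Nat.zero_le 1)
  refine exists_prog_of_table (Γ₀ := tableCtx (k := k) id fun _ => 0)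
    (Γ₁ := tableCtx Sigma.fst fun p => p.2)
    (Γ₂ := tableCtx (k := k) id fun I => tableSize k (inputMem I))
    (base := fun I => tableBase (inputMem I)) (V := fun I => tableValue k (inputMem I))
    (mem := inputMem) (τ := fun I => 2 ^ typeCount (inputMem I) + 1)
    (Nat.zero_le 1) (fun I s hs => hs.trans (h0 I).symm) (fun _ => rfl) (fun _ _ hs => hs)
    (fun _ => rfl) (fun _ _ hs => hs) rfl rfl hN ?_ ?_ ?_
  · exact (polyTime_tableBase.add hvar).congr fun p => congrArg (· + _)
      (tableBase_congr (memAt_of_lt p.1 p.2)).symm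
  · exact (polyTime_entry k hvar).congr fun p => (entry_eq_tableValue k (inputMem p.1) p.2).symm
  · exact (computes_answer k).mono fun I => by
      change 2 ^ typeCount (memAt I _) + 1 ≤ _
      rw [typeCount_congr (memAt_of_lt I _)]

theorem answer_memAt (hk : 1 ≤ k) (I : MHEInstance k) :
    (I.IsYes → answer k (memAt I (tableSize k (inputMem I))) = 1) ∧
      (¬ I.IsYes → answer k (memAt I (tableSize k (inputMem I))) = 0) := by
  have h := memAt_of_lt I (tableSize k (inputMem I))
  refine ((encodes_inputMem I).congr h).answer_eq hk fun c hc S hS => ?_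
  rw [typeCount_congr h] at hS ⊢
  rw [tableBase_congr h, index_congr h, memAt, tableMem_base_add (index_lt _ hc hS),
    tableValue_index k _ c le_rfl hS]
  congr 1
  funext T
  exact (weight_congr h c T).symm

end HappyEdges

/-! ### The main theorem -/

theorem mainTheorem9 (k : ℕ) (hk : 1 ≤ k) :
    ∃ (P : RAM.Prog) (p : Polynomial ℕ),
      RAM.DecidesInTime P MHEInstance.encode (MHEInstance.IsYes (k := k))
        (fun I => 2 ^ I.graph.neighborhoodDiversity * p.eval (I.n + Nat.size I.ℓ.natAbs)) := by
  obtain ⟨P, q, hP⟩ := HappyEdges.exists_prog k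
  -- The table size and the `2 ^ t` terms of the final sum give `k * (t + 1) * 2 ^ t + 2 ^ t + 2 ≤ 2
  -- ^ t * (k * (t + 1) + 3)`, and `t` is at most the number of vertices.
  refine ⟨P, (Polynomial.C k * (Polynomial.X + 1) + 3) * q, fun I => ?_⟩
  obtain ⟨T, s, h1, h2, h3⟩ := hP I (RAM.start I.encode) rfl
  have hE := HappyEdges.encodes_inputMem I
  refine ⟨T, s, h1, h2.trans ?_, ?_⟩
  · beta_reduce
    rw [Polynomial.eval_mul, ← mul_assoc]
    refine Nat.mul_le_mul_right _ ?_
    have ht : HappyEdges.typeCount (HappyEdges.inputMem I) ≤ I.n + Nat.size I.ℓ.natAbs :=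
      (HappyEdges.typeCount_le _).trans (hE.size.le.trans (Nat.le_add_right _ _))
    have hd := Nat.pow_le_pow_right two_pos hE.typeCount_le_neighborhoodDiversity
    have hpos := Nat.one_le_two_pow (n := HappyEdges.typeCount (HappyEdges.inputMem I))
    simp only [Polynomial.eval_add, Polynomial.eval_mul, Polynomial.eval_C, Polynomial.eval_X,
      Polynomial.eval_one, Polynomial.eval_ofNat, HappyEdges.tableSize]
    calc _ ≤ 2 ^ HappyEdges.typeCount (HappyEdges.inputMem I) *
          (k * (HappyEdges.typeCount (HappyEdges.inputMem I) + 1) + 3) := by linarith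
      _ ≤ _ := Nat.mul_le_mul hd (by gcongr)
  · rw [h3]
    exact HappyEdges.answer_memAt hk I
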